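/- Let $(X,d)$ be a geodesic metric space, i.e. any two points $x,y\in X$ are joined by a path of length $d(x,y)$. Let $G$ be an Abelian group, let $s>0$, and let $S\subset X$ be an $s$-dense subset (for each $x\in X$ there is $y\in S$ with $d(x,y)<s$), equipped with the restriction of $d$, and let $\bullet\in S$ be a basepoint. For a metric space $Y$ and $r>0$ let $\operatorname{Rips}(Y,r)$ be the open Rips complex: the simplicial complex with vertex set $Y$ whose simplices are the nonempty finite subsets of $Y$ of diameter $<r$. A based $r$-loop in $Y$ is a sequence $L=(\bullet=x_0,x_1,\ldots,x_n=\bullet)$ of points of $Y$ with $d(x_i,x_{i+1})<r$ for all $i$; it represents an element $[L]\in\pi_1(\operatorname{Rips}(Y,r),\bullet)$ and, for each $g\in G$, the class $g[L]_G\in H_1(\operatorname{Rips}(Y,r);G)$ of the cycle $\sum_i g\cdot(x_i,x_{i+1})$. Then: 1. For $2s\le p$ the maps $\mu_p\colon\pi_1(\operatorname{Rips}(S,p),\bullet)\to\pi_1(\operatorname{Rips}(X,p),\bullet)$ and $\mu_p\colon H_1(\operatorname{Rips}(S,p);G)\to H_1(\operatorname{Rips}(X,p);G)$ induced by the inclusion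 $S\hookrightarrow X$ are surjective. 2. For $2s\le p<q$ and for each of $Y=S$ and $Y=X$, the bonding maps $i_{p,q}\colon\pi_1(\operatorname{Rips}(Y,p),\bullet)\to\pi_1(\operatorname{Rips}(Y,q),\bullet)$ and $i_{p,q}\colon H_1(\operatorname{Rips}(Y,p);G)\to H_1(\operatorname{Rips}(Y,q);G)$ induced by the identity on vertices are surjective. 3. For every $p>0$ there are unique homomorphisms $\nu_p\colon\pi_1(\operatorname{Rips}(X,p),\bullet)\to\pi_1(\operatorname{Rips}(S,p+2s),\bullet)$ and $\nu_p\colon H_1(\operatorname{Rips}(X,p);G)\to H_1(\operatorname{Rips}(S,p+2s);G)$ such that $\nu_p([L])=[L_S]$, respectively $\nu_p(g[L]_G)=g[L_S]_G$ for all $g\in G$, whenever $L=(\bullet=x_0,\ldots,x_n=\bullet)$ is a based $p$-loop in $X$ and $L_S=(\bullet=y_0,\ldots,y_n=\bullet)$ is a based $(p+2s)$-loop in $S$ with $d(x_i,y_i)<s$ for all $i$. Both maps $\nu_p$ are surjective. -/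

import Mathlib

/-! Geodesic spaces, dense subsets, open Rips complexes; fundamental group and first homology of an
abstract simplicial complex; the inclusion-induced maps and the map `ν`. -/

noncomputable section

/-- A metric space is geodesic if any two points `x`, `y` are joined by a path whose length
is `d(x, y)`. -/
def IsGeodesicSpace (X : Type*) [MetricSpace X] : Prop :=
  ∀ x y : X, ∃ γ : Path x y, eVariationOn γ Set.univ = edist x y

/-- `S` is `s`-dense: every point of `X` is at distance less than `s` from a point of `S`. -/
def IsDenseAt {X : Type*} [MetricSpace X] (S : Set X) (s : ℝ) : Prop :=
  ∀ x : X, ∃ y ∈ S, dist x y < s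

/-- The open Rips complex: nonempty finite sets of diameter less than `r`. -/
def Rips (X : Type*) [MetricSpace X] (r : ℝ) (hr : 0 < r) : AbstractSimplicialComplex X where
  faces := {σ | σ.Nonempty ∧ Metric.diam (σ : Set X) < r}
  isRelLowerSet_faces := fun σ hσ =>
    ⟨hσ.1, fun τ hτσ hτ =>
      ⟨hτ, (Metric.diam_mono (Finset.coe_subset.2 hτσ) σ.finite_toSet.isBounded).trans_lt hσ.2⟩⟩
  singleton_mem := fun v => ⟨Finset.singleton_nonempty v, by simpa using hr⟩

namespace AbstractSimplicialComplex

variable {V W : Type*}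

/-- `a` and `b` lie in a common simplex (`a = b` is allowed). -/
def Adj (K : AbstractSimplicialComplex V) (a b : V) : Prop :=
  ∃ σ ∈ K.faces, a ∈ σ ∧ b ∈ σ

/-- A vertex map is simplicial if the vertices of every simplex are sent to vertices of some
simplex (equivalently, the image of a simplex is a simplex). -/
def IsSimplicialMap (K : AbstractSimplicialComplex V) (L : AbstractSimplicialComplex W)
    (f : V → W) : Prop :=
  ∀ σ ∈ K.faces, ∃ τ ∈ L.faces, ∀ v ∈ σ, f v ∈ τ

/-! ### Geometric realization -/

/-- The geometric realization: finitely supported barycentric coordinates, nonnegative with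
sum one, whose support is a simplex. -/
def Realization (K : AbstractSimplicialComplex V) : Type _ :=
  {w : V →₀ ℝ // (∀ v, 0 ≤ w v) ∧ (w.sum fun _ a => a) = 1 ∧ w.support ∈ K.faces}

theorem support_mem_of_subset (K : AbstractSimplicialComplex V) {w : V →₀ ℝ}
    (hw : (w.sum fun _ a => a) = 1) {σ : Finset V} (hσ : σ ∈ K.faces) (h : w.support ⊆ σ) :
    w.support ∈ K.faces := by
  refine (K.isRelLowerSet_faces hσ).2 h ?_
  rw [Finsupp.support_nonempty_iff]
  rintro rfl
  simp at hw

theorem mapDomain_nonneg (f : V → W) {w : V →₀ ℝ} (hw : ∀ v, 0 ≤ w v) (u : W) :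
    0 ≤ Finsupp.mapDomain f w u := by
  classical
  rw [Finsupp.mapDomain, Finsupp.sum, Finsupp.finsetSum_apply]
  refine Finset.sum_nonneg fun v _ => ?_
  rw [Finsupp.single_apply]
  split_ifs
  exacts [hw v, le_rfl]

theorem mapDomain_sum (f : V → W) (w : V →₀ ℝ) :
    ((Finsupp.mapDomain f w).sum fun _ a => a) = w.sum fun _ a => a :=
  Finsupp.sum_mapDomain_index (fun _ => rfl) (fun _ _ _ => rfl)

/-- The inclusion of a closed simplex in the realization. -/
def simplexIncl (K : AbstractSimplicialComplex V) (σ : Finset V) (hσ : σ ∈ K.faces)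
    (w : stdSimplex ℝ σ) : Realization K :=
  ⟨Finsupp.mapDomain Subtype.val (Finsupp.equivFunOnFinite.symm (w : σ → ℝ)), by
    have h1 : ((Finsupp.mapDomain Subtype.val
        (Finsupp.equivFunOnFinite.symm (w : σ → ℝ))).sum fun (_ : V) (a : ℝ) => a) = 1 := by
      rw [mapDomain_sum, Finsupp.sum_fintype _ _ (fun _ => rfl)]
      exact w.2.2
    refine ⟨mapDomain_nonneg _ fun v => w.2.1 v, h1, support_mem_of_subset K h1 hσ ?_⟩
    classical
    refine Finsupp.mapDomain_support.trans ?_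
    intro v hv
    obtain ⟨u, _, rfl⟩ := Finset.mem_image.1 hv
    exact u.2⟩

/-- The coherent (weak) topology: a set is open iff its trace on each closed simplex is open. -/
instance (K : AbstractSimplicialComplex V) : TopologicalSpace (Realization K) :=
  ⨆ σ : K.faces, TopologicalSpace.coinduced (simplexIncl K σ.1 σ.2) inferInstance

theorem continuous_simplexIncl (K : AbstractSimplicialComplex V) (σ : Finset V)
    (hσ : σ ∈ K.faces) : Continuous (simplexIncl K σ hσ) :=
  continuous_iff_coinduced_le.2 (le_iSup (fun σ : K.faces =>
    TopologicalSpace.coinduced (simplexIncl K σ.1 σ.2) inferInstance) ⟨σ, hσ⟩)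

/-- A vertex as a point of the realization. -/
def vertex (K : AbstractSimplicialComplex V) (v : V) : Realization K :=
  ⟨Finsupp.single v 1, by
    refine ⟨fun u => ?_, by simp, ?_⟩
    · classical
      rw [Finsupp.single_apply]
      split_ifs <;> norm_num
    · rw [Finsupp.support_single v one_ne_zero]
      exact K.singleton_mem v⟩

/-- The affine extension of a simplicial map to realizations. -/
def realizationMap {K : AbstractSimplicialComplex V} {L : AbstractSimplicialComplex W} {f : V → W}
    (hf : IsSimplicialMap K L f) : C(Realization K, Realization L) where
  toFun w := ⟨Finsupp.mapDomain f w.1, by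
    have h1 : ((Finsupp.mapDomain f w.1).sum fun (_ : W) (a : ℝ) => a) = 1 := by
      rw [mapDomain_sum]; exact w.2.2.1
    obtain ⟨τ, hτ, h⟩ := hf _ w.2.2.2
    refine ⟨mapDomain_nonneg _ w.2.1, h1, support_mem_of_subset L h1 hτ ?_⟩
    classical
    refine Finsupp.mapDomain_support.trans ?_
    intro u hu
    obtain ⟨v, hv, rfl⟩ := Finset.mem_image.1 hu
    exact h v hv⟩
  continuous_toFun := by
    refine continuous_iSup_dom.2 fun σ => continuous_coinduced_dom.2 ?_
    obtain ⟨τ, hτ, h⟩ := hf _ σ.2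
    have h2 := (continuous_simplexIncl L τ hτ).comp
      (stdSimplex.continuous_map (S := ℝ) (fun v : σ.1 => (⟨f v.1, h v.1 v.2⟩ : τ)))
    refine h2.congr fun w => Subtype.ext ?_
    change Finsupp.mapDomain Subtype.val (Finsupp.equivFunOnFinite.symm
      (Finsupp.equivFunOnFinite (Finsupp.mapDomain (fun v : σ.1 => (⟨f v.1, h v.1 v.2⟩ : τ))
        (Finsupp.equivFunOnFinite.symm (w : σ.1 → ℝ))))) = Finsupp.mapDomain f
      (Finsupp.mapDomain Subtype.val (Finsupp.equivFunOnFinite.symm (w : σ.1 → ℝ)))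
    rw [Equiv.symm_apply_apply, ← Finsupp.mapDomain_comp, ← Finsupp.mapDomain_comp]
    rfl

theorem realizationMap_vertex {K : AbstractSimplicialComplex V} {L : AbstractSimplicialComplex W}
    {f : V → W} (hf : IsSimplicialMap K L f) (v : V) :
    realizationMap hf (vertex K v) = vertex L (f v) :=
  Subtype.ext Finsupp.mapDomain_single

/-! ### Fundamental group -/

/-- `π₁(K, v)`: the fundamental group of the realization at the vertex `v`. -/
abbrev Pi1 (K : AbstractSimplicialComplex V) (v : V) : Type _ :=
  FundamentalGroup (Realization K) (vertex K v)

/-- The homomorphism induced by a simplicial map with `f v = u`. -/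
def pi1Map {K : AbstractSimplicialComplex V} {L : AbstractSimplicialComplex W} {f : V → W}
    (hf : IsSimplicialMap K L f) {v : V} {u : W} (h : f v = u) : Pi1 K v →* Pi1 L u :=
  FundamentalGroup.mapOfEq (realizationMap hf) ((realizationMap_vertex hf v).trans (by rw [h]))

/-- The straight path `t ↦ (1 - t) a + t b` between two vertices of a simplex. -/
def segment (K : AbstractSimplicialComplex V) {a b : V} (h : K.Adj a b) :
    Path (vertex K a) (vertex K b) where
  toFun t := ⟨(1 - (t : ℝ)) • Finsupp.single a 1 + (t : ℝ) • Finsupp.single b 1, by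
    classical
    have h1 : (((1 - (t : ℝ)) • Finsupp.single a 1 + (t : ℝ) • Finsupp.single b 1 :
        V →₀ ℝ).sum fun _ x => x) = 1 := by
      rw [Finsupp.sum_add_index (fun _ _ => rfl) (fun _ _ _ _ => rfl), Finsupp.smul_single,
        Finsupp.smul_single, Finsupp.sum_single_index rfl, Finsupp.sum_single_index rfl]
      simp
    obtain ⟨σ, hσ, ha, hb⟩ := h
    refine ⟨fun v => ?_, h1, support_mem_of_subset K h1 hσ ?_⟩
    · have ht0 := t.2.1
      have ht1 : 0 ≤ 1 - (t : ℝ) := sub_nonneg.2 t.2.2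
      simp only [Finsupp.add_apply, Finsupp.smul_apply, Finsupp.single_apply, smul_eq_mul]
      split_ifs <;> simp <;> linarith
    · intro v hv
      by_contra hvσ
      have hav : a ≠ v := fun e => hvσ (e ▸ ha)
      have hbv : b ≠ v := fun e => hvσ (e ▸ hb)
      simp [hav, hbv] at hv⟩
  source' := Subtype.ext (by simp [vertex])
  target' := Subtype.ext (by simp [vertex])
  continuous_toFun := by
    classical
    obtain ⟨σ, hσ, ha, hb⟩ := h
    let g : unitInterval → stdSimplex ℝ σ := fun t =>
      ⟨(1 - (t : ℝ)) • Pi.single ⟨a, ha⟩ 1 + (t : ℝ) • Pi.single ⟨b, hb⟩ 1,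
        convex_stdSimplex ℝ σ (single_mem_stdSimplex ℝ _) (single_mem_stdSimplex ℝ _)
          (sub_nonneg.2 t.2.2) t.2.1 (by ring)⟩
    have hg : Continuous g := by
      refine Continuous.subtype_mk ?_ _
      fun_prop
    refine ((continuous_simplexIncl K σ hσ).comp hg).congr fun t => Subtype.ext ?_
    have e : (Finsupp.equivFunOnFinite.symm ((1 - (t : ℝ)) • Pi.single (⟨a, ha⟩ : σ) (1 : ℝ) +
        (t : ℝ) • Pi.single ⟨b, hb⟩ 1)) = (1 - (t : ℝ)) • Finsupp.single (⟨a, ha⟩ : σ) (1 : ℝ) +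
        (t : ℝ) • Finsupp.single ⟨b, hb⟩ 1 := by
      ext v
      simp only [Finsupp.coe_equivFunOnFinite_symm, Pi.add_apply, Pi.smul_apply, Finsupp.add_apply,
        Finsupp.smul_apply, Finsupp.single_apply, Pi.single_apply, eq_comm]
    change Finsupp.mapDomain Subtype.val (Finsupp.equivFunOnFinite.symm
      ((1 - (t : ℝ)) • Pi.single (⟨a, ha⟩ : σ) (1 : ℝ) + (t : ℝ) • Pi.single ⟨b, hb⟩ 1)) = _
    rw [e, Finsupp.mapDomain_add, Finsupp.mapDomain_smul, Finsupp.mapDomain_smul,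
      Finsupp.mapDomain_single, Finsupp.mapDomain_single]

/-- The edge path through the vertices `x 0, x 1, …, x n`. -/
def edgePath (K : AbstractSimplicialComplex V) (x : ℕ → V) :
    (n : ℕ) → (∀ i < n, K.Adj (x i) (x (i + 1))) → Path (vertex K (x 0)) (vertex K (x n))
  | 0, _ => Path.refl _
  | n + 1, h => (edgePath K x n fun i hi => h i (hi.trans n.lt_succ_self)).trans
      (segment K (h n n.lt_succ_self))

/-- The class in `π₁(K, v)` of a closed edge path based at `v`. -/
def pi1Class (K : AbstractSimplicialComplex V) {v : V} (x : ℕ → V) (n : ℕ) (h0 : x 0 = v)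
    (hn : x n = v) (h : ∀ i < n, K.Adj (x i) (x (i + 1))) : Pi1 K v :=
  FundamentalGroup.fromPath (Path.Homotopic.Quotient.mk
    ((edgePath K x n h).cast (congrArg (vertex K) h0.symm) (congrArg (vertex K) hn.symm)))

/-! ### First simplicial homology, through the ordered chain complex -/

variable (G : Type*) [AddCommGroup G]

/-- Ordered `n`-simplices: `(n + 1)`-tuples (repetitions allowed) of vertices of a simplex. -/
def OrdSimplex (K : AbstractSimplicialComplex V) (n : ℕ) : Type _ :=
  {v : Fin (n + 1) → V // ∃ σ ∈ K.faces, ∀ i, v i ∈ σ}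

/-- Ordered `n`-chains with coefficients in `G`. -/
abbrev OrdChain (K : AbstractSimplicialComplex V) (n : ℕ) : Type _ :=
  OrdSimplex K n →₀ G

/-- Omit the `i`-th vertex. -/
def OrdSimplex.face {K : AbstractSimplicialComplex V} {n : ℕ} (v : OrdSimplex K (n + 1))
    (i : Fin (n + 2)) : OrdSimplex K n :=
  ⟨fun j => v.1 (i.succAbove j), by
    obtain ⟨σ, hσ, h⟩ := v.2
    exact ⟨σ, hσ, fun _ => h _⟩⟩

/-- `∂ (g · (v₀, …, vₙ₊₁)) = ∑ i, (-1)ⁱ g · (v₀, …, v̂ᵢ, …, vₙ₊₁)`. -/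
def boundary (K : AbstractSimplicialComplex V) (n : ℕ) : OrdChain G K (n + 1) →+ OrdChain G K n :=
  Finsupp.liftAddHom fun v => ∑ i : Fin (n + 2),
    ((-1 : ℤ) ^ (i : ℕ)) • Finsupp.singleAddHom (v.face i)

/-- `H₁(K; G)`: one-cycles modulo boundaries of two-chains. -/
abbrev H1 (K : AbstractSimplicialComplex V) : Type _ :=
  (boundary G K 0).ker ⧸ ((boundary G K 1).range.addSubgroupOf (boundary G K 0).ker)

/-- A simplicial map on ordered simplices. -/
def OrdSimplex.map {K : AbstractSimplicialComplex V} {L : AbstractSimplicialComplex W} {f : V → W}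
    (hf : IsSimplicialMap K L f) {n : ℕ} (v : OrdSimplex K n) : OrdSimplex L n :=
  ⟨fun j => f (v.1 j), by
    obtain ⟨σ, hσ, h⟩ := v.2
    obtain ⟨τ, hτ, h'⟩ := hf σ hσ
    exact ⟨τ, hτ, fun j => h' _ (h j)⟩⟩

/-- The induced map on chains. -/
def chainMap {K : AbstractSimplicialComplex V} {L : AbstractSimplicialComplex W} {f : V → W}
    (hf : IsSimplicialMap K L f) (n : ℕ) : OrdChain G K n →+ OrdChain G L n :=
  Finsupp.mapDomain.addMonoidHom (OrdSimplex.map hf)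

theorem boundary_chainMap {K : AbstractSimplicialComplex V} {L : AbstractSimplicialComplex W}
    {f : V → W} (hf : IsSimplicialMap K L f) (n : ℕ) (c : OrdChain G K (n + 1)) :
    boundary G L n (chainMap G hf (n + 1) c) = chainMap G hf n (boundary G K n c) := by
  suffices h : (boundary G L n).comp (chainMap G hf (n + 1)) =
      (chainMap G hf n).comp (boundary G K n) from DFunLike.congr_fun h c
  refine Finsupp.addHom_ext fun v g => ?_
  simp only [AddMonoidHom.comp_apply, chainMap, Finsupp.mapDomain.addMonoidHom_apply,
    Finsupp.mapDomain_single, boundary, Finsupp.liftAddHom_apply_single,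
    AddMonoidHom.finsetSum_apply, map_sum, AddMonoidHom.smul_apply, Finsupp.singleAddHom_apply]
  refine Finset.sum_congr rfl fun i _ => ?_
  rw [← Finsupp.mapDomain.addMonoidHom_apply, map_zsmul, Finsupp.mapDomain.addMonoidHom_apply,
    Finsupp.mapDomain_single]
  rfl

/-- The induced map on cycles. -/
def cycleMap {K : AbstractSimplicialComplex V} {L : AbstractSimplicialComplex W} {f : V → W}
    (hf : IsSimplicialMap K L f) : (boundary G K 0).ker →+ (boundary G L 0).ker :=
  ((chainMap G hf 1).comp (boundary G K 0).ker.subtype).codRestrict _ fun c => by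
    rw [AddMonoidHom.mem_ker, AddMonoidHom.comp_apply, boundary_chainMap]
    rw [show boundary G K 0 ((boundary G K 0).ker.subtype c) = 0 from c.2, map_zero]

/-- The homomorphism on `H₁` induced by a simplicial map. -/
def h1Map {K : AbstractSimplicialComplex V} {L : AbstractSimplicialComplex W} {f : V → W}
    (hf : IsSimplicialMap K L f) : H1 G K →+ H1 G L :=
  QuotientAddGroup.map _ _ (cycleMap G hf) (by
    rintro c ⟨b, hb⟩
    exact ⟨chainMap G hf 2 b, by rw [boundary_chainMap, hb]; rfl⟩)

/-- The edge `(a, b)` as an ordered simplex. -/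
def ordEdge {K : AbstractSimplicialComplex V} {a b : V} (h : K.Adj a b) : OrdSimplex K 1 :=
  ⟨![a, b], by
    obtain ⟨σ, hσ, ha, hb⟩ := h
    exact ⟨σ, hσ, Fin.forall_fin_two.2 ⟨ha, hb⟩⟩⟩

/-- The vertex `a` as an ordered simplex. -/
def ordVertex (K : AbstractSimplicialComplex V) (a : V) : OrdSimplex K 0 :=
  ⟨fun _ => a, ⟨{a}, K.singleton_mem a, fun _ => Finset.mem_singleton_self a⟩⟩

variable {G}

theorem boundary_ordEdge {K : AbstractSimplicialComplex V} {a b : V} (h : K.Adj a b) (g : G) :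
    boundary G K 0 (Finsupp.single (ordEdge h) g) =
      Finsupp.single (ordVertex K b) g - Finsupp.single (ordVertex K a) g := by
  have e0 : (ordEdge h).face 0 = ordVertex K b := Subtype.ext (by
    funext j; fin_cases j; rfl)
  have e1 : (ordEdge h).face 1 = ordVertex K a := Subtype.ext (by
    funext j; fin_cases j; rfl)
  simp [boundary, Fin.sum_univ_two, e0, e1, sub_eq_add_neg]

/-- The class in `H₁(K; G)` of the cycle `∑ i < n, g · (x i, x (i + 1))` of a closed edge path. -/
def h1Class (K : AbstractSimplicialComplex V) {v : V} (x : ℕ → V) (n : ℕ) (h0 : x 0 = v)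
    (hn : x n = v) (h : ∀ i < n, K.Adj (x i) (x (i + 1))) (g : G) : H1 G K :=
  QuotientAddGroup.mk
    ⟨∑ i : Fin n, Finsupp.single (ordEdge (h i i.2)) g, by
      rw [AddMonoidHom.mem_ker, map_sum]
      simp only [boundary_ordEdge]
      rw [Fin.sum_univ_eq_sum_range (fun i => Finsupp.single (ordVertex K (x (i + 1))) g -
        Finsupp.single (ordVertex K (x i)) g) n,
        Finset.sum_range_sub (fun i => Finsupp.single (ordVertex K (x i)) g), h0, hn, sub_self]⟩

end AbstractSimplicialComplex

open AbstractSimplicialComplex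

/-! ### The maps between Rips complexes -/

section RipsMaps

variable {X : Type*} [MetricSpace X]

theorem rips_adj {r : ℝ} (hr : 0 < r) {a b : X} (h : dist a b < r) : (Rips X r hr).Adj a b := by
  classical
  refine ⟨{a, b}, ⟨⟨a, by simp⟩, ?_⟩, by simp, by simp⟩
  rw [Finset.coe_pair, Metric.diam_pair]
  exact h

theorem isSimplicialMap_bond {p q : ℝ} (hp : 0 < p) (hq : 0 < q) (hpq : p ≤ q) :
    IsSimplicialMap (Rips X p hp) (Rips X q hq) id :=
  fun σ hσ => ⟨σ, ⟨hσ.1, hσ.2.trans_le hpq⟩, fun _ hv => hv⟩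

theorem isSimplicialMap_incl (S : Set X) {p : ℝ} (hp : 0 < p) :
    IsSimplicialMap (Rips S p hp) (Rips X p hp) Subtype.val := by
  intro σ hσ
  refine ⟨σ.map (Function.Embedding.subtype _), ⟨hσ.1.map, ?_⟩, fun v hv => by simpa using hv⟩
  have h := (isometry_subtype_coe (s := S)).diam_image (σ : Set S)
  rw [Finset.coe_map]
  exact h.trans_lt hσ.2

/-- The bonding map `i_{p,q} : π₁(Rips(X, p), x₀) → π₁(Rips(X, q), x₀)`. -/
def bondPi1 {p q : ℝ} (hp : 0 < p) (hq : 0 < q) (hpq : p ≤ q) (x₀ : X) :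
    Pi1 (Rips X p hp) x₀ →* Pi1 (Rips X q hq) x₀ :=
  pi1Map (isSimplicialMap_bond hp hq hpq) rfl

/-- The bonding map `i_{p,q} : H₁(Rips(X, p); G) → H₁(Rips(X, q); G)`. -/
def bondH1 (X : Type*) [MetricSpace X] (G : Type*) [AddCommGroup G] {p q : ℝ} (hp : 0 < p)
    (hq : 0 < q) (hpq : p ≤ q) : H1 G (Rips X p hp) →+ H1 G (Rips X q hq) :=
  h1Map G (isSimplicialMap_bond hp hq hpq)

/-- `μ_p : π₁(Rips(S, p), x₀) → π₁(Rips(X, p), x₀)`, induced by the inclusion of `S`. -/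
def muPi1 (S : Set X) {p : ℝ} (hp : 0 < p) (x₀ : S) :
    Pi1 (Rips S p hp) x₀ →* Pi1 (Rips X p hp) (x₀ : X) :=
  pi1Map (isSimplicialMap_incl S hp) rfl

/-- `μ_p : H₁(Rips(S, p); G) → H₁(Rips(X, p); G)`, induced by the inclusion of `S`. -/
def muH1 (G : Type*) [AddCommGroup G] (S : Set X) {p : ℝ} (hp : 0 < p) :
    H1 G (Rips S p hp) →+ H1 G (Rips X p hp) :=
  h1Map G (isSimplicialMap_incl S hp)

/-- A based `r`-loop `x 0, x 1, …, x n` (only these values of `x` matter). -/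
structure RLoop (X : Type*) [MetricSpace X] (r : ℝ) (x₀ : X) where
  n : ℕ
  x : ℕ → X
  first : x 0 = x₀
  last : x n = x₀
  step : ∀ i < n, dist (x i) (x (i + 1)) < r

/-- `[L] ∈ π₁(Rips(X, r), x₀)`. -/
def RLoop.pi1Class {r : ℝ} {x₀ : X} (L : RLoop X r x₀) (hr : 0 < r) : Pi1 (Rips X r hr) x₀ :=
  AbstractSimplicialComplex.pi1Class (Rips X r hr) L.x L.n L.first L.last
    fun i hi => rips_adj hr (L.step i hi)

/-- `g · [L] ∈ H₁(Rips(X, r); G)`. -/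
def RLoop.h1Class {G : Type*} [AddCommGroup G] {r : ℝ} {x₀ : X} (L : RLoop X r x₀) (hr : 0 < r)
    (g : G) : H1 G (Rips X r hr) :=
  AbstractSimplicialComplex.h1Class (Rips X r hr) L.x L.n L.first L.last
    (fun i hi => rips_adj hr (L.step i hi)) g

/-- `L'` is an `s`-approximation in `S` of the loop `L` of `X`: it has the same number of vertices
and corresponding vertices are at distance less than `s`. -/
def RLoop.Approximates {S : Set X} {r r' : ℝ} {x₀ : S} (L' : RLoop S r' x₀)
    (L : RLoop X r (x₀ : X)) (s : ℝ) : Prop :=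
  L'.n = L.n ∧ ∀ i ≤ L.n, dist (L.x i) (L'.x i : X) < s

/-- `ν` is the homomorphism `ν_p : π₁(Rips(X, p), x₀) → π₁(Rips(S, p + 2s), x₀)`: it sends `[L]` to
`[L']` whenever `L` is a based `p`-loop in `X` and `L'` an `s`-approximation of it in `S`. -/
def IsNuPi1 {S : Set X} {p s : ℝ} (hp : 0 < p) (hps : 0 < p + 2 * s) (x₀ : S)
    (ν : Pi1 (Rips X p hp) (x₀ : X) →* Pi1 (Rips S (p + 2 * s) hps) x₀) : Prop :=
  ∀ (L : RLoop X p (x₀ : X)) (L' : RLoop S (p + 2 * s) x₀), L'.Approximates L s →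
    ν (L.pi1Class hp) = L'.pi1Class hps

/-- `ν` is the homomorphism `ν_p : H₁(Rips(X, p); G) → H₁(Rips(S, p + 2s); G)`: it sends `g · [L]`
to `g · [L']` whenever `L` is a based `p`-loop in `X` and `L'` an `s`-approximation of it in `S`. -/
def IsNuH1 {G : Type*} [AddCommGroup G] {S : Set X} {p s : ℝ} (hp : 0 < p) (hps : 0 < p + 2 * s)
    (x₀ : S) (ν : H1 G (Rips X p hp) →+ H1 G (Rips S (p + 2 * s) hps)) : Prop :=
  ∀ (L : RLoop X p (x₀ : X)) (L' : RLoop S (p + 2 * s) x₀), L'.Approximates L s →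
    ∀ g : G, ν (L.h1Class hp g) = L'.h1Class hps g

end RipsMaps

end

/-! The argument reduces everything to edge walks. A path between two vertices of a realization,
subdivided so that each piece lies in one open star, is homotopic to an edge path
(`exists_edgeWalk_homotopic`), so every element of `π₁` is the class of a closed edge walk. In a
complex joined by edge walks, the classes `g · [w]` of closed walks at one vertex generate `H₁`
(`loopSubgroup_eq_top`). Combinatorially equivalent walks are homotopic and homologous; the converse
is never needed.

Hence a simplicial map `f` is onto on `π₁` and `H₁` as soon as there is a vertex map `t` backwards,
with `f (t w)` adjacent to `w`, such that each edge `(a, b)`, conjugated by these short edges, is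
equivalent to the image of a walk from `t a` to `t b` (`surjective_pi1Map`, `surjective_h1Map`).

For Rips complexes such walks come from geodesics. An edge is subdivided along a geodesic, and a
Lebesgue number gives points of `S` such that two consecutive ones are within `s` of a common
geodesic point, hence less than `2s` apart (`IsGeodesicSpace.exists_seq`). The fine walk is carried
back to the edge by filling ladders with triangles (`rips_contiguous`) and by coning the first half
of the geodesic to one end and the second half to the other (`rips_collapse`).

The map `ν` is induced by a vertex retraction `f : X → S` moving points by less than `s`. An
approximation of a loop is contiguous to its image under `f`, so `f` induces a map with the required
values; it is unique because loops generate. -/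

noncomputable section

open AbstractSimplicialComplex

namespace AbstractSimplicialComplex
open Topology

/-! ### Topology of the realization: coordinates and closed simplices -/

section RealizationTopology

variable {V : Type*} {K : AbstractSimplicialComplex V}

theorem simplexIncl_apply_of_mem {σ : Finset V} (hσ : σ ∈ K.faces) (w : stdSimplex ℝ σ) {v : V}
    (hv : v ∈ σ) : (simplexIncl K σ hσ w).1 v = w ⟨v, hv⟩ :=
  Finsupp.mapDomain_apply Subtype.val_injective _ (⟨v, hv⟩ : σ)

theorem simplexIncl_apply_of_notMem {σ : Finset V} (hσ : σ ∈ K.faces) (w : stdSimplex ℝ σ) {v : V}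
    (hv : v ∉ σ) : (simplexIncl K σ hσ w).1 v = 0 :=
  Finsupp.mapDomain_of_notMem_range _ _ (by simpa using hv)

theorem continuous_coord (v : V) : Continuous fun w : Realization K => w.1 v := by
  refine continuous_iSup_dom.2 fun σ => continuous_coinduced_dom.2 ?_
  by_cases hv : v ∈ σ.1
  · refine Continuous.congr (f := fun w : stdSimplex ℝ σ.1 => (w : σ.1 → ℝ) ⟨v, hv⟩) ?_
      fun w => (simplexIncl_apply_of_mem σ.2 w hv).symm
    exact (continuous_apply _).comp continuous_subtype_val
  · exact (continuous_const (y := (0 : ℝ))).congr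
      fun w => (simplexIncl_apply_of_notMem σ.2 w hv).symm

theorem Realization.ext_coord {w w' : Realization K} (h : ∀ v, w.1 v = w'.1 v) : w = w' :=
  Subtype.ext (Finsupp.ext h)

instance : T2Space (Realization K) :=
  T2Space.of_injective_continuous (f := fun (w : Realization K) (v : V) => w.1 v)
    (fun _ _ h => Realization.ext_coord (congrFun h)) (continuous_pi continuous_coord)

/-- A closed simplex is compact and the realization is Hausdorff, since its points are separated by
the continuous barycentric coordinates; a continuous injection is then a closed embedding. -/
theorem isEmbedding_simplexIncl {σ : Finset V} (hσ : σ ∈ K.faces) :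
    IsEmbedding (simplexIncl K σ hσ) := by
  refine ((continuous_simplexIncl K σ hσ).isClosedEmbedding fun w w' h => ?_).isEmbedding
  refine Subtype.ext (funext fun v => ?_)
  have := congrArg (fun u : Realization K => u.1 v.1) h
  simp only [simplexIncl_apply_of_mem hσ _ v.2] at this
  exact this

theorem mem_range_simplexIncl {σ : Finset V} (hσ : σ ∈ K.faces) {w : Realization K}
    (hw : w.1.support ⊆ σ) : w ∈ Set.range (simplexIncl K σ hσ) := by
  have hsum : ∑ v : σ, w.1 v = 1 := by
    have h1 := Finsupp.sum_of_support_subset w.1 hw (fun _ a => a) (fun _ _ => rfl)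
    exact (Finset.sum_coe_sort σ (fun v => w.1 v)).trans (h1.symm.trans w.2.2.1)
  refine ⟨⟨fun v => w.1 v, fun v => w.2.1 v, hsum⟩, Realization.ext_coord fun v => ?_⟩
  by_cases hv : v ∈ σ
  · exact simplexIncl_apply_of_mem hσ _ hv
  · rw [simplexIncl_apply_of_notMem hσ _ hv]
    exact (Finsupp.notMem_support_iff.1 fun h => hv (hw h)).symm

theorem contractibleSpace_stdSimplex_of_mem {σ : Finset V} (hσ : σ ∈ K.faces) :
    ContractibleSpace (stdSimplex ℝ σ) := by
  classical
  obtain ⟨v, hv⟩ := (K.isRelLowerSet_faces hσ).1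
  exact (convex_stdSimplex ℝ σ).contractibleSpace ⟨_, single_mem_stdSimplex ℝ (⟨v, hv⟩ : σ)⟩

theorem exists_straight_path {σ : Finset V} (hσ : σ ∈ K.faces) {p q : Realization K}
    (hp : p.1.support ⊆ σ) (hq : q.1.support ⊆ σ) :
    ∃ γ : Path p q, ∀ t v, (γ t).1 v = (1 - (t : ℝ)) * p.1 v + t * q.1 v := by
  obtain ⟨a, rfl⟩ := mem_range_simplexIncl hσ hp
  obtain ⟨b, rfl⟩ := mem_range_simplexIncl hσ hq
  let g : unitInterval → stdSimplex ℝ σ := fun t =>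
    ⟨(1 - (t : ℝ)) • (a : σ → ℝ) + (t : ℝ) • (b : σ → ℝ), convex_stdSimplex ℝ σ a.2 b.2
      (sub_nonneg.2 t.2.2) t.2.1 (by ring)⟩
  have hg : Continuous g := by
    refine Continuous.subtype_mk ?_ _
    fun_prop
  refine ⟨⟨⟨fun t => simplexIncl K σ hσ (g t), (continuous_simplexIncl K σ hσ).comp hg⟩, ?_, ?_⟩,
    fun t v => ?_⟩
  · refine congrArg (simplexIncl K σ hσ) (Subtype.ext ?_)
    change (1 - ((0 : unitInterval) : ℝ)) • (a : σ → ℝ) + ((0 : unitInterval) : ℝ) • (b : σ → ℝ) = a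
    rw [Set.Icc.coe_zero, sub_zero, one_smul, zero_smul, add_zero]
  · refine congrArg (simplexIncl K σ hσ) (Subtype.ext ?_)
    change (1 - ((1 : unitInterval) : ℝ)) • (a : σ → ℝ) + ((1 : unitInterval) : ℝ) • (b : σ → ℝ) = b
    rw [Set.Icc.coe_one, sub_self, one_smul, zero_smul, zero_add]
  · change (simplexIncl K σ hσ (g t)).1 v = _
    by_cases hv : v ∈ σ
    · simp only [simplexIncl_apply_of_mem hσ _ hv]
      rfl
    · simp [simplexIncl_apply_of_notMem hσ _ hv]

end RealizationTopology

/-! ### Paths inside a simply connected piece -/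

section Homotopy

variable {Y Z : Type*} [TopologicalSpace Y] [TopologicalSpace Z]

/-- Both paths lift through the embedding, and the lifts are homotopic in `Y`. It is applied to open
stars and to closed simplices. -/
theorem homotopic_of_mem_range [SimplyConnectedSpace Y] {e : Y → Z}
    (he : IsEmbedding e) {p q : Z} (γ γ' : Path p q) (h : ∀ t, γ t ∈ Set.range e)
    (h' : ∀ t, γ' t ∈ Set.range e) : γ.Homotopic γ' := by
  obtain ⟨a, rfl⟩ : p ∈ Set.range e := by simpa using h 0
  obtain ⟨b, rfl⟩ : q ∈ Set.range e := by simpa using h 1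
  have lift : ∀ δ : Path (e a) (e b), (∀ t, δ t ∈ Set.range e) →
      ∃ δ' : Path a b, δ'.map he.continuous = δ := by
    intro δ hδ
    choose f hf using hδ
    refine ⟨⟨⟨f, ?_⟩, ?_, ?_⟩, ?_⟩
    · rw [he.isInducing.continuous_iff]
      exact δ.continuous.congr fun t => (hf t).symm
    · exact he.injective ((hf 0).trans δ.source)
    · exact he.injective ((hf 1).trans δ.target)
    · ext t
      exact hf t
  obtain ⟨δ, rfl⟩ := lift γ h
  obtain ⟨δ', rfl⟩ := lift γ' h'
  exact (SimplyConnectedSpace.paths_homotopic δ δ').map ⟨e, he.continuous⟩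

end Homotopy

/-! ### Open stars are contractible -/

section OpenStar

variable {V : Type*} (K : AbstractSimplicialComplex V)

/-- The open star of a vertex: the points whose barycentric coordinate at `v` is positive. -/
def openStar (v : V) : Set (Realization K) :=
  {w | 0 < w.1 v}

theorem isOpen_openStar (v : V) : IsOpen (openStar K v) :=
  isOpen_lt continuous_const (continuous_coord v)

variable {K}

theorem exists_mem_openStar (w : Realization K) : ∃ v, w ∈ openStar K v := by
  obtain ⟨v, hv⟩ := (K.isRelLowerSet_faces w.2.2.2).1
  exact ⟨v, (w.2.1 v).lt_of_ne' (Finsupp.mem_support_iff.1 hv)⟩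

theorem mem_support_of_mem_openStar {v : V} {w : Realization K} (h : w ∈ openStar K v) :
    v ∈ w.1.support :=
  Finsupp.mem_support_iff.2 (ne_of_gt h)

theorem vertex_mem_openStar_iff {u v : V} : vertex K u ∈ openStar K v ↔ u = v := by
  classical
  change 0 < (Finsupp.single u (1 : ℝ)) v ↔ _
  rw [Finsupp.single_apply]
  split_ifs with h <;> simp [h]

theorem support_vertex_subset {v : V} {σ : Finset V} (h : v ∈ σ) :
    (vertex K v).1.support ⊆ σ :=
  Finsupp.support_single_subset.trans (Finset.singleton_subset_iff.2 h)

/-- Because the star is open in the realization, its subspace topology is again coherent with its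
traces on the closed simplices. -/
theorem openStar_continuous_iff {Z : Type*} [TopologicalSpace Z] {v : V} {f : openStar K v → Z}
    (hf : ∀ (σ : Finset V) (hσ : σ ∈ K.faces), Continuous
      fun w : {w : stdSimplex ℝ σ // simplexIncl K σ hσ w ∈ openStar K v} => f ⟨_, w.2⟩) :
    Continuous f := by
  refine ⟨fun U hU => ?_⟩
  suffices h : IsOpen (Subtype.val '' (f ⁻¹' U)) by
    have := h.preimage (continuous_subtype_val (p := fun w => w ∈ openStar K v))
    rwa [Set.preimage_image_eq _ Subtype.val_injective] at this
  refine isOpen_iSup_iff.2 fun σ => isOpen_coinduced.2 ?_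
  have h1 := (hf σ.1 σ.2).isOpen_preimage U hU
  have h2 := ((isOpen_openStar K v).preimage
    (continuous_simplexIncl K σ.1 σ.2)).isOpenMap_subtype_val _ h1
  convert h2 using 1
  ext w
  constructor
  · rintro ⟨x, hx, hxw⟩
    refine ⟨⟨w, ?_⟩, ?_, rfl⟩
    · change simplexIncl K σ.1 σ.2 w ∈ openStar K v
      rw [← hxw]; exact x.2
    · change f ⟨simplexIncl K σ.1 σ.2 w, _⟩ ∈ U
      have e : x = ⟨simplexIncl K σ.1 σ.2 w, hxw ▸ x.2⟩ := Subtype.ext hxw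
      rw [← e]; exact hx
  · rintro ⟨x, hx, rfl⟩
    exact ⟨⟨_, x.2⟩, hx, rfl⟩

/-- The straight-line contraction of an open star to its vertex. -/
def starContraction (v : V) (w : openStar K v) (t : unitInterval) : openStar K v :=
  ⟨⟨(1 - (t : ℝ)) • w.1.1 + (t : ℝ) • Finsupp.single v 1, by
    classical
    have h1 : (((1 - (t : ℝ)) • w.1.1 + (t : ℝ) • Finsupp.single v 1 :
        V →₀ ℝ).sum fun _ x => x) = 1 := by
      rw [Finsupp.sum_add_index (fun _ _ => rfl) (fun _ _ _ _ => rfl), Finsupp.smul_single,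
        Finsupp.sum_single_index rfl, Finsupp.sum_smul_index (fun _ => rfl), ← Finsupp.mul_sum,
        w.1.2.2.1]
      simp
    refine ⟨fun u => ?_, h1, support_mem_of_subset K h1 w.1.2.2.2 fun u hu => ?_⟩
    · have h2 := mul_nonneg (sub_nonneg.2 t.2.2) (w.1.2.1 u)
      have h3 := mul_nonneg t.2.1 ((vertex K v).2.1 u)
      exact add_nonneg h2 h3
    · by_contra hn
      have hw : w.1.1 u = 0 := Finsupp.notMem_support_iff.1 hn
      have huv : v ≠ u := fun e => hn (e ▸ mem_support_of_mem_openStar w.2)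
      simp [hw, huv] at hu⟩, by
    have hw : 0 < w.1.1 v := w.2
    change 0 < (1 - (t : ℝ)) * w.1.1 v + (t : ℝ) * (Finsupp.single v (1 : ℝ)) v
    rw [Finsupp.single_eq_same, mul_one]
    rcases t.2.1.eq_or_lt with h | h
    · rw [← h]; simpa using hw
    · exact add_pos_of_nonneg_of_pos (mul_nonneg (sub_nonneg.2 t.2.2) hw.le) h⟩

theorem continuous_starContraction_simplexIncl (v : V) (σ : Finset V) (hσ : σ ∈ K.faces) :
    Continuous fun x : {w : stdSimplex ℝ σ // simplexIncl K σ hσ w ∈ openStar K v} × unitInterval =>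
      starContraction v ⟨simplexIncl K σ hσ x.1.1, x.1.2⟩ x.2 := by
    classical
    by_cases hv : v ∈ σ
    · refine Continuous.subtype_mk ?_ _
      let g : {w : stdSimplex ℝ σ // simplexIncl K σ hσ w ∈ openStar K v} × unitInterval →
          stdSimplex ℝ σ :=
        fun x => ⟨(1 - (x.2 : ℝ)) • (x.1.1 : σ → ℝ) + (x.2 : ℝ) • Pi.single ⟨v, hv⟩ 1,
          convex_stdSimplex ℝ σ x.1.1.2 (single_mem_stdSimplex ℝ _)
            (sub_nonneg.2 x.2.2.2) x.2.2.1 (by ring)⟩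
      have hg : Continuous g := by
        refine Continuous.subtype_mk ?_ _
        have h1 : Continuous fun x : {w : stdSimplex ℝ σ //
            simplexIncl K σ hσ w ∈ openStar K v} × unitInterval => (x.1.1 : σ → ℝ) :=
          continuous_subtype_val.comp (continuous_subtype_val.comp continuous_fst)
        fun_prop
      refine ((continuous_simplexIncl K σ hσ).comp hg).congr fun x =>
        Realization.ext_coord fun u => ?_
      change (simplexIncl K σ hσ (g x)).1 u = (1 - (x.2 : ℝ)) * (simplexIncl K σ hσ x.1.1).1 u
        + (x.2 : ℝ) * (Finsupp.single v (1 : ℝ)) u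
      by_cases hu : u ∈ σ
      · rw [simplexIncl_apply_of_mem hσ _ hu, simplexIncl_apply_of_mem hσ _ hu]
        change (1 - (x.2 : ℝ)) * x.1.1 ⟨u, hu⟩ + (x.2 : ℝ) *
          (Pi.single (⟨v, hv⟩ : σ) (1 : ℝ) : σ → ℝ) ⟨u, hu⟩ = _
        simp [Pi.single_apply, Finsupp.single_apply, eq_comm]
      · have huv : v ≠ u := fun e => hu (e ▸ hv)
        simp [simplexIncl_apply_of_notMem hσ _ hu, huv]
    · have : IsEmpty {w : stdSimplex ℝ σ // simplexIncl K σ hσ w ∈ openStar K v} :=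
        ⟨fun w => (simplexIncl_apply_of_notMem hσ w.1 hv).not_gt w.2⟩
      exact continuous_of_const fun x => (this.false x.1).elim

theorem continuous_starContraction_apply {v : V} (w : openStar K v) :
    Continuous (starContraction v w) := by
  obtain ⟨w, hw⟩ := w
  obtain ⟨σ, hσ, a, rfl⟩ : ∃ σ, ∃ hσ : σ ∈ K.faces, ∃ a, simplexIncl K σ hσ a = w :=
    ⟨_, w.2.2.2, mem_range_simplexIncl w.2.2.2 (subset_refl _)⟩
  have h : Continuous fun t : unitInterval =>
      ((⟨a, hw⟩, t) : {w' // simplexIncl K σ hσ w' ∈ openStar K v} × unitInterval) := by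
    fun_prop
  have h' := (continuous_starContraction_simplexIncl v σ hσ).comp h
  exact h'

/-- Joint continuity cannot be tested simplex by simplex on the product directly. The contraction is
curried to a map into `C(unitInterval, openStar K v)`, tested on each simplex there, and uncurried,
which is legitimate since the interval is locally compact. -/
theorem continuous_starContraction (v : V) :
    Continuous fun x : unitInterval × openStar K v => starContraction v x.2 x.1 := by
  let F : openStar K v → C(unitInterval, openStar K v) :=
    fun w => ⟨starContraction v w, continuous_starContraction_apply w⟩
  have hF : Continuous F := by
    refine openStar_continuous_iff fun σ hσ => ?_
    refine ContinuousMap.continuous_of_continuous_uncurry _ ?_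
    have h := continuous_starContraction_simplexIncl v σ hσ
    exact h
  have h := (ContinuousMap.continuous_uncurry_of_continuous ⟨F, hF⟩).comp continuous_swap
  exact h

theorem contractibleSpace_openStar (v : V) : ContractibleSpace (openStar K v) := by
  refine (contractible_iff_id_nullhomotopic _).2
    ⟨⟨vertex K v, vertex_mem_openStar_iff.2 rfl⟩, ⟨⟨⟨_, continuous_starContraction v⟩, ?_, ?_⟩⟩⟩
  · intro w
    exact Subtype.ext (Subtype.ext (by simp [starContraction]))
  · intro w
    exact Subtype.ext (Subtype.ext (by simp [starContraction, vertex]))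

theorem homotopic_of_mem_openStar {v : V} {p q : Realization K} (γ γ' : Path p q)
    (h : ∀ t, γ t ∈ openStar K v) (h' : ∀ t, γ' t ∈ openStar K v) : γ.Homotopic γ' := by
  have := contractibleSpace_openStar (K := K) v
  exact homotopic_of_mem_range IsEmbedding.subtypeVal γ γ' (fun t => ⟨⟨_, h t⟩, rfl⟩)
    (fun t => ⟨⟨_, h' t⟩, rfl⟩)

theorem homotopic_of_support_subset {σ : Finset V} (hσ : σ ∈ K.faces) {p q : Realization K}
    (γ γ' : Path p q) (h : ∀ t, (γ t).1.support ⊆ σ) (h' : ∀ t, (γ' t).1.support ⊆ σ) :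
    γ.Homotopic γ' := by
  have := contractibleSpace_stdSimplex_of_mem hσ
  exact homotopic_of_mem_range (isEmbedding_simplexIncl hσ) γ γ'
    (fun t => mem_range_simplexIncl hσ (h t)) (fun t => mem_range_simplexIncl hσ (h' t))

end OpenStar
-- Edge walks and their combinatorial homotopies
variable {V W : Type*}

/-- Edge walks in a simplicial complex; consecutive vertices lie in a common simplex. -/
inductive EdgeWalk (K : AbstractSimplicialComplex V) (a : V) : V → Type _
  | nil : EdgeWalk K a a
  | snoc {b c : V} (w : EdgeWalk K a b) (h : K.Adj b c) : EdgeWalk K a c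

namespace EdgeWalk

variable {K : AbstractSimplicialComplex V} {L : AbstractSimplicialComplex W} {a b c d : V}

/-- The edge walk with one edge. -/
abbrev single (h : K.Adj a b) : EdgeWalk K a b :=
  nil.snoc h

/-- Concatenation of edge walks. -/
def append (w : EdgeWalk K a b) : {c : V} → EdgeWalk K b c → EdgeWalk K a c
  | _, nil => w
  | _, snoc u h => (w.append u).snoc h

/-- The image of an edge walk under a simplicial map. -/
def map {f : V → W} (hf : IsSimplicialMap K L f) : {b : V} → EdgeWalk K a b →
    EdgeWalk L (f a) (f b)
  | _, nil => nil
  | _, snoc u h => (u.map hf).snoc (by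
      obtain ⟨σ, hσ, ha, hb⟩ := h
      obtain ⟨τ, hτ, hστ⟩ := hf σ hσ
      exact ⟨τ, hτ, hστ _ ha, hστ _ hb⟩)

/-- The edge walk through the vertices `x 0, …, x n`. -/
def ofSeq (x : ℕ → V) : (n : ℕ) → (∀ i < n, K.Adj (x i) (x (i + 1))) → EdgeWalk K (x 0) (x n)
  | 0, _ => nil
  | n + 1, h => (ofSeq x n fun i hi => h i (hi.trans n.lt_succ_self)).snoc (h n n.lt_succ_self)

/-- Change the end points along equalities. -/
def copy {a' b' : V} (ha : a = a') (hb : b = b') (w : EdgeWalk K a b) : EdgeWalk K a' b' :=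
  ha ▸ hb ▸ w

/-- The combinatorial homotopy relation on edge walks. -/
inductive Equiv : {a b : V} → EdgeWalk K a b → EdgeWalk K a b → Prop
  | refl {a b : V} (w : EdgeWalk K a b) : Equiv w w
  | symm {a b : V} {w w' : EdgeWalk K a b} : Equiv w w' → Equiv w' w
  | trans {a b : V} {w w' w'' : EdgeWalk K a b} : Equiv w w' → Equiv w' w'' → Equiv w w''
  | append {a b c : V} {w w' : EdgeWalk K a b} {u u' : EdgeWalk K b c} :
      Equiv w w' → Equiv u u' → Equiv (w.append u) (w'.append u')
  | loop {a : V} (h : K.Adj a a) : Equiv (single h) nil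
  | triangle {a b c : V} {σ : Finset V} (hσ : σ ∈ K.faces) (ha : a ∈ σ) (hb : b ∈ σ) (hc : c ∈ σ)
      (hab : K.Adj a b) (hbc : K.Adj b c) (hac : K.Adj a c) :
      Equiv ((single hab).append (single hbc)) (single hac)

theorem append_assoc (w : EdgeWalk K a b) (u : EdgeWalk K b c) (t : EdgeWalk K c d) :
    (w.append u).append t = w.append (u.append t) := by
  induction t with
  | nil => rfl
  | snoc t h ih => simp only [append, ih]

theorem nil_append (w : EdgeWalk K a b) : nil.append w = w := by
  induction w with
  | nil => rfl
  | snoc t h ih => simp only [append, ih]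

theorem append_nil (w : EdgeWalk K a b) : w.append nil = w := rfl

theorem append_single (w : EdgeWalk K a b) (h : K.Adj b c) : w.append (single h) = w.snoc h := rfl

theorem map_append {f : V → W} (hf : IsSimplicialMap K L f) (w : EdgeWalk K a b)
    (u : EdgeWalk K b c) : (w.append u).map hf = (w.map hf).append (u.map hf) := by
  induction u with
  | nil => rfl
  | snoc t h ih => simp only [append, map, ih]

theorem nil_copy {a' : V} (h h' : a = a') : (nil : EdgeWalk K a a).copy h h' = nil := by
  subst h
  rfl

theorem snoc_copy {a' b' c' : V} (ha : a = a') (hb : b = b') (hc : c = c') (w : EdgeWalk K a b)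
    (h : K.Adj b c) (h' : K.Adj b' c') :
    (w.copy ha hb).snoc h' = (w.snoc h).copy ha hc := by
  subst ha hb hc
  rfl

theorem ofSeq_congr {x y : ℕ → V} {n : ℕ} (hxy : ∀ i ≤ n, y i = x i)
    (hx : ∀ i < n, K.Adj (x i) (x (i + 1))) (hy : ∀ i < n, K.Adj (y i) (y (i + 1))) :
    ofSeq x n hx = (ofSeq y n hy).copy (hxy 0 n.zero_le) (hxy n le_rfl) := by
  induction n with
  | zero => exact (nil_copy _ _).symm
  | succ n ih =>
    simp only [ofSeq]
    rw [ih (fun i hi => hxy i (hi.trans n.le_succ)) (fun i hi => hx i (hi.trans n.lt_succ_self))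
      (fun i hi => hy i (hi.trans n.lt_succ_self))]
    exact snoc_copy _ _ _ _ _ _

theorem exists_seq (w : EdgeWalk K a b) : ∃ (x : ℕ → V) (n : ℕ) (h0 : x 0 = a) (hn : x n = b)
    (h : ∀ i < n, K.Adj (x i) (x (i + 1))), w = (ofSeq x n h).copy h0 hn := by
  classical
  induction w with
  | nil => exact ⟨fun _ => a, 0, rfl, rfl, by simp, rfl⟩
  | @snoc b c w hbc ih =>
    obtain ⟨x, n, rfl, rfl, h, rfl⟩ := ih
    let y : ℕ → V := fun i => if i ≤ n then x i else c
    have hy : ∀ i ≤ n, y i = x i := fun i hi => if_pos hi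
    have hyn : y (n + 1) = c := if_neg (by omega)
    have h1 : ∀ i < n, K.Adj (y i) (y (i + 1)) := fun i hi => by
      rw [hy i hi.le, hy (i + 1) hi]; exact h i hi
    have h2 : ∀ i < n + 1, K.Adj (y i) (y (i + 1)) := fun i hi => by
      rcases Nat.lt_succ_iff_lt_or_eq.1 hi with hi | rfl
      · exact h1 i hi
      · rw [hy i le_rfl, hyn]; exact hbc
    refine ⟨y, n + 1, hy 0 n.zero_le, hyn, h2, ?_⟩
    rw [ofSeq_congr hy h h1]
    exact snoc_copy (hy 0 n.zero_le) (hy n le_rfl) hyn (ofSeq y n h1) (h2 n n.lt_succ_self) hbc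

/-! ### Homotopy classes of the associated paths -/

/-- The path in the realization along an edge walk. -/
def toPath : {b : V} → EdgeWalk K a b → Path (vertex K a) (vertex K b)
  | _, nil => Path.refl _
  | _, snoc w h => w.toPath.trans (segment K h)

theorem toPath_ofSeq (x : ℕ → V) (n : ℕ) (h : ∀ i < n, K.Adj (x i) (x (i + 1))) :
    (ofSeq x n h).toPath = edgePath K x n h := by
  induction n with
  | zero => rfl
  | succ n ih => simp only [ofSeq, toPath, edgePath, ih]

theorem toPath_copy {a' b' : V} (ha : a = a') (hb : b = b') (w : EdgeWalk K a b) :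
    (w.copy ha hb).toPath = w.toPath.cast (congrArg _ ha.symm) (congrArg _ hb.symm) := by
  subst ha hb
  rfl

theorem toPath_append (w : EdgeWalk K a b) (u : EdgeWalk K b c) :
    (w.append u).toPath.Homotopic (w.toPath.trans u.toPath) := by
  induction u with
  | nil => exact ⟨(Path.Homotopy.transRefl _).symm⟩
  | snoc t h ih =>
    exact (ih.hcomp (Path.Homotopic.refl _)).trans ⟨Path.Homotopy.transAssoc _ _ _⟩

theorem support_segment_subset (h : K.Adj a b) {σ : Finset V} (ha : a ∈ σ) (hb : b ∈ σ)
    (t : unitInterval) : (segment K h t).1.support ⊆ σ := by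
  classical
  refine Finsupp.support_add.trans (Finset.union_subset ?_ ?_)
  · exact Finsupp.support_smul.trans (support_vertex_subset (K := K) ha)
  · exact Finsupp.support_smul.trans (support_vertex_subset (K := K) hb)

theorem support_trans_subset {p q r : Realization K} {γ : Path p q} {γ' : Path q r}
    {σ : Finset V} (h : ∀ t, (γ t).1.support ⊆ σ) (h' : ∀ t, (γ' t).1.support ⊆ σ)
    (t : unitInterval) : (γ.trans γ' t).1.support ⊆ σ := by
  have ht : γ.trans γ' t ∈ Set.range γ ∪ Set.range γ' := Path.trans_range γ γ' ▸ ⟨t, rfl⟩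
  rcases ht with ⟨s, hs⟩ | ⟨s, hs⟩
  · rw [← hs]; exact h s
  · rw [← hs]; exact h' s

theorem Equiv.toPath_homotopic {w w' : EdgeWalk K a b} (h : w.Equiv w') :
    w.toPath.Homotopic w'.toPath := by
  induction h with
  | refl w => exact Path.Homotopic.refl _
  | symm _ ih => exact ih.symm
  | trans _ _ ih ih' => exact ih.trans ih'
  | append _ _ ih ih' =>
    exact (toPath_append _ _).trans ((ih.hcomp ih').trans (toPath_append _ _).symm)
  | loop h =>
    obtain ⟨σ, hσ, ha, -⟩ := id h
    exact homotopic_of_support_subset hσ _ _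
      (support_trans_subset (fun _ => support_vertex_subset ha) (support_segment_subset h ha ha))
      (fun _ => support_vertex_subset ha)
  | triangle hσ ha hb hc hab hbc hac =>
    refine homotopic_of_support_subset hσ _ _ ?_ ?_
    · exact support_trans_subset (support_trans_subset (fun _ => support_vertex_subset ha)
        (support_segment_subset hab ha hb)) (support_segment_subset hbc hb hc)
    · exact support_trans_subset (fun _ => support_vertex_subset ha)
        (support_segment_subset hac ha hc)

/-- The realization map is affine on each segment, so the two paths agree pointwise and not merely
up to homotopy. -/
theorem toPath_map {f : V → W} (hf : IsSimplicialMap K L f) (w : EdgeWalk K a b) :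
    (w.map hf).toPath = (w.toPath.map (realizationMap hf).continuous).cast
      (realizationMap_vertex hf a).symm (realizationMap_vertex hf b).symm := by
  induction w with
  | nil =>
    ext t
    exact (realizationMap_vertex hf a).symm
  | @snoc b c w h ih =>
    simp only [map, toPath, ih]
    have key : ∀ h' : L.Adj (f b) (f c), segment L h' =
        ((segment K h).map (realizationMap hf).continuous).cast
          (realizationMap_vertex hf b).symm (realizationMap_vertex hf c).symm := by
      intro h'
      ext t
      refine Subtype.ext ?_
      change (1 - (t : ℝ)) • Finsupp.single (f b) (1 : ℝ) + (t : ℝ) • Finsupp.single (f c) 1 =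
        Finsupp.mapDomain f ((1 - (t : ℝ)) • Finsupp.single b 1 + (t : ℝ) • Finsupp.single c 1)
      rw [Finsupp.mapDomain_add, Finsupp.mapDomain_smul, Finsupp.mapDomain_smul,
        Finsupp.mapDomain_single, Finsupp.mapDomain_single]
    rw [key]
    ext t
    simp only [Path.cast_coe, Path.map_coe, Path.trans_apply, Function.comp_apply]
    split_ifs <;> rfl

end EdgeWalk

/-! ### Paths between vertices are homotopic to edge walks -/

variable {K : AbstractSimplicialComplex V}

theorem exists_path_mem_openStar {v : V} {p : Realization K} (hp : p ∈ openStar K v) :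
    ∃ ρ : Path (vertex K v) p, (∀ t, ρ t ∈ openStar K v) ∧ ∀ t, (ρ t).1.support ⊆ p.1.support := by
  classical
  have hv := mem_support_of_mem_openStar hp
  obtain ⟨ρ, hρ⟩ := exists_straight_path p.2.2.2 (support_vertex_subset hv) (subset_refl _)
  refine ⟨ρ, fun t => ?_, fun t u hu => ?_⟩
  · change 0 < (ρ t).1 v
    rw [hρ t v]
    change 0 < (1 - (t : ℝ)) * (Finsupp.single v (1 : ℝ)) v + (t : ℝ) * p.1 v
    rw [Finsupp.single_eq_same, mul_one]
    have hpv : 0 < p.1 v := hp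
    rcases t.2.2.eq_or_lt with h | h
    · rw [h]; simpa using hpv
    · exact add_pos_of_pos_of_nonneg (sub_pos.2 h) (mul_nonneg t.2.1 hpv.le)
  · by_contra hn
    have hpu : p.1 u = 0 := Finsupp.notMem_support_iff.1 hn
    have huv : v ≠ u := fun e => hn (e ▸ hv)
    have hvu : (vertex K v).1 u = 0 := Finsupp.single_eq_of_ne' huv
    refine Finsupp.mem_support_iff.1 hu ?_
    rw [hρ t u, hpu, hvu, mul_zero, mul_zero, add_zero]

theorem mem_openStar_trans {v : V} {p q r : Realization K} {γ : Path p q} {γ' : Path q r}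
    (h : ∀ t, γ t ∈ openStar K v) (h' : ∀ t, γ' t ∈ openStar K v) (t : unitInterval) :
    γ.trans γ' t ∈ openStar K v := by
  have ht : γ.trans γ' t ∈ Set.range γ ∪ Set.range γ' := Path.trans_range γ γ' ▸ ⟨t, rfl⟩
  rcases ht with ⟨s, hs⟩ | ⟨s, hs⟩
  · rw [← hs]; exact h s
  · rw [← hs]; exact h' s

/-- Subdivide the interval so that each piece of `γ` lies in one open star. Two stars that share a
point have adjacent centres, since both centres lie in the support of that point; the successive
centres form the walk. -/
theorem exists_edgeWalk_homotopic {a b : V} (γ : Path (vertex K a) (vertex K b)) :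
    ∃ w : EdgeWalk K a b, γ.Homotopic w.toPath := by
  obtain ⟨t, ht0, htm, ⟨m, hm⟩, ht⟩ := exists_monotone_Icc_subset_open_cover_unitInterval
    (c := fun v => γ ⁻¹' openStar K v) (fun v => (isOpen_openStar K v).preimage γ.continuous)
    (fun s _ => Set.mem_iUnion.2 (exists_mem_openStar (γ s)))
  -- Invariant: up to time `t n`, the path is a walk to a vertex `u` followed by a tail `ρ` that
  -- stays in the star of `u`.
  have step : ∀ n, ∃ (u : V) (w : EdgeWalk K a u) (ρ : Path (vertex K u) (γ (t n))),
      (∀ s, ρ s ∈ openStar K u) ∧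
      ((γ.subpath 0 (t n)).cast γ.source.symm rfl).Homotopic (w.toPath.trans ρ) := by
    intro n
    induction n with
    | zero =>
      have h0 : γ (t 0) = vertex K a := by rw [ht0, γ.source]
      refine ⟨a, .nil, (Path.refl _).cast rfl h0, fun s => vertex_mem_openStar_iff.2 rfl, ?_⟩
      refine homotopic_of_mem_openStar (v := a) _ _ (fun s => ?_) (mem_openStar_trans
        (fun s => vertex_mem_openStar_iff.2 rfl) (fun s => vertex_mem_openStar_iff.2 rfl))
      have hs : γ.subpath 0 (t 0) s = vertex K a := by
        rw [ht0, Path.subpath_self, Path.refl_apply, γ.source]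
      rw [Path.cast_coe, hs]
      exact vertex_mem_openStar_iff.2 rfl
    | succ n ih =>
      obtain ⟨u, w, ρ, hρ, hw⟩ := ih
      obtain ⟨v, hv⟩ := ht n
      have hnn := htm n.le_succ
      have hu : γ (t n) ∈ openStar K u := by simpa using hρ 1
      have hvn : γ (t n) ∈ openStar K v := hv ⟨le_rfl, hnn⟩
      have hσ := (γ (t n)).2.2.2
      have huσ := mem_support_of_mem_openStar hu
      have hvσ := mem_support_of_mem_openStar hvn
      have hadj : K.Adj u v := ⟨_, hσ, huσ, hvσ⟩
      obtain ⟨ρ₀, hρ₀, hρ₀'⟩ := exists_path_mem_openStar hu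
      obtain ⟨ρ₁, hρ₁, hρ₁'⟩ := exists_path_mem_openStar hvn
      -- Change of centre from `u` to `v`: inside the star of `u` the tail becomes straight, and
      -- then everything takes place in the simplex supporting `γ (t n)`.
      have e : ρ.Homotopic ((segment K hadj).trans ρ₁) :=
        (homotopic_of_mem_openStar ρ ρ₀ hρ hρ₀).trans (homotopic_of_support_subset hσ _ _ hρ₀'
          (EdgeWalk.support_trans_subset (EdgeWalk.support_segment_subset hadj huσ hvσ) hρ₁'))
      have hsub : ∀ s, γ.subpath (t n) (t (n + 1)) s ∈ openStar K v := fun s => by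
        have : γ.subpath (t n) (t (n + 1)) s ∈ γ '' Set.Icc (t n) (t (n + 1)) :=
          Path.range_subpath_of_le γ _ _ hnn ▸ ⟨s, rfl⟩
        obtain ⟨s', hs', h⟩ := this
        rw [← h]
        exact hv hs'
      refine ⟨v, w.snoc hadj, ρ₁.trans (γ.subpath (t n) (t (n + 1))),
        mem_openStar_trans hρ₁ hsub, ?_⟩
      have h1 : (((γ.subpath 0 (t n)).trans (γ.subpath (t n) (t (n + 1)))).cast γ.source.symm
          rfl).Homotopic ((γ.subpath 0 (t (n + 1))).cast γ.source.symm rfl) :=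
        Path.Homotopic.pathCast ⟨Path.Homotopy.subpathTransSubpath γ 0 (t n) (t (n + 1))⟩ _ _
      refine h1.symm.trans ?_
      have h2 : (((γ.subpath 0 (t n)).trans (γ.subpath (t n) (t (n + 1)))).cast γ.source.symm
          rfl) = ((γ.subpath 0 (t n)).cast γ.source.symm rfl).trans
            (γ.subpath (t n) (t (n + 1))) := rfl
      rw [h2]
      refine ((hw.trans ((Path.Homotopic.refl _).hcomp e)).hcomp (Path.Homotopic.refl _)).trans ?_
      refine Path.Homotopic.trans ⟨Path.Homotopy.transAssoc _ _ _⟩ ?_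
      refine ((Path.Homotopic.refl _).hcomp ⟨Path.Homotopy.transAssoc _ _ _⟩).trans ?_
      exact ⟨(Path.Homotopy.transAssoc _ _ _).symm⟩
  obtain ⟨u, w, ρ, hρ, hw⟩ := step m
  have h1 : t m = 1 := hm m le_rfl
  have hb : γ (t m) = vertex K b := by rw [h1, γ.target]
  -- The only open star containing a vertex is its own, so the last centre is `b` and the remaining
  -- tail is a loop in a contractible star.
  obtain rfl : b = u := by
    have := hρ 1
    rw [ρ.target, hb] at this
    exact vertex_mem_openStar_iff.1 this
  refine ⟨w, ?_⟩
  have h2 := hw.pathCast rfl hb.symm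
  have h3 : (((γ.subpath 0 (t m)).cast γ.source.symm rfl).cast rfl hb.symm) = γ := by
    ext s
    simp only [Path.cast_coe]
    rw [h1, Path.subpath_zero_one, Path.cast_coe]
  rw [h3] at h2
  refine h2.trans ?_
  have h4 : ((w.toPath.trans ρ).cast rfl hb.symm) = w.toPath.trans (ρ.cast rfl hb.symm) := rfl
  rw [h4]
  refine ((Path.Homotopic.refl _).hcomp (homotopic_of_mem_openStar (v := b) _ (Path.refl _) hρ
    fun s => vertex_mem_openStar_iff.2 rfl)).trans ⟨Path.Homotopy.transRefl _⟩

variable {V W : Type*}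

theorem Adj.symm {K : AbstractSimplicialComplex V} {a b : V} (h : K.Adj a b) : K.Adj b a := by
  obtain ⟨σ, hσ, ha, hb⟩ := h
  exact ⟨σ, hσ, hb, ha⟩

theorem Adj.refl (K : AbstractSimplicialComplex V) (a : V) : K.Adj a a :=
  ⟨{a}, K.singleton_mem a, Finset.mem_singleton_self a, Finset.mem_singleton_self a⟩

/-! ### Calculus of walks: cancellation, reversal and conjugation -/

namespace EdgeWalk

variable {K : AbstractSimplicialComplex V} {L : AbstractSimplicialComplex W} {a b c d : V}

theorem Equiv.append_left {u u' : EdgeWalk K b c} (w : EdgeWalk K a b) (h : u.Equiv u') :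
    (w.append u).Equiv (w.append u') :=
  (Equiv.refl w).append h

theorem Equiv.append_right {w w' : EdgeWalk K a b} (h : w.Equiv w') (u : EdgeWalk K b c) :
    (w.append u).Equiv (w'.append u) :=
  h.append (Equiv.refl u)

theorem Equiv.cancel (h : K.Adj a b) (h' : K.Adj b a) :
    ((single h).append (single h')).Equiv nil := by
  obtain ⟨σ, hσ, ha, hb⟩ := id h
  exact (Equiv.triangle hσ ha hb ha h h' (Adj.refl K a)).trans (Equiv.loop _)

/-- The reversed edge walk. -/
def reverse : {b : V} → EdgeWalk K a b → EdgeWalk K b a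
  | _, nil => nil
  | _, snoc w h => (single h.symm).append w.reverse

theorem Equiv.append_reverse (w : EdgeWalk K a b) : (w.append w.reverse).Equiv nil := by
  induction w with
  | nil => exact Equiv.refl _
  | @snoc b c w h ih =>
    have h1 : (w.snoc h).append (w.snoc h).reverse =
        w.append (((single h).append (single h.symm)).append w.reverse) := by
      rw [append_assoc, ← append_assoc, append_single]
      rfl
    rw [h1]
    have h2 := ((Equiv.cancel h h.symm).append_right w.reverse).append_left w
    rw [nil_append] at h2
    exact h2.trans ih

/-- Once the end points are identified, the conjugating edges are degenerate and `Equiv.loop`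
removes them. -/
theorem Equiv.copy_of_conj {a' b' : V} (ha : a = a') (hb : b = b') (e : K.Adj a a')
    (e' : K.Adj b' b) {w : EdgeWalk K a b} {w' : EdgeWalk K a' b'}
    (h : w.Equiv ((single e).append (w'.append (single e')))) : (w.copy ha hb).Equiv w' := by
  subst ha hb
  refine h.trans (((Equiv.loop e).append (((Equiv.loop e').append_left w'))).trans ?_)
  rw [nil_append, append_nil]
  exact Equiv.refl _

/-! ### Classes in the fundamental group -/

/-- The class of a closed edge walk in the fundamental group. -/
def pi1Class (w : EdgeWalk K a a) : Pi1 K a :=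
  FundamentalGroup.fromPath (Path.Homotopic.Quotient.mk w.toPath)

theorem Equiv.pi1Class_eq {w w' : EdgeWalk K a a} (h : w.Equiv w') : w.pi1Class = w'.pi1Class :=
  Path.Homotopic.Quotient.eq.2 h.toPath_homotopic

theorem exists_pi1Class_eq (γ : Pi1 K a) : ∃ w : EdgeWalk K a a, w.pi1Class = γ := by
  obtain ⟨p, rfl⟩ := Path.Homotopic.Quotient.mk_surjective γ
  obtain ⟨w, hw⟩ := exists_edgeWalk_homotopic p
  exact ⟨w, Path.Homotopic.Quotient.eq.2 hw.symm⟩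

theorem pi1Class_copy_ofSeq {x : ℕ → V} {n : ℕ} (h0 : x 0 = a) (hn : x n = a)
    (h : ∀ i < n, K.Adj (x i) (x (i + 1))) :
    ((ofSeq x n h).copy h0 hn).pi1Class = AbstractSimplicialComplex.pi1Class K x n h0 hn h := by
  rw [pi1Class, toPath_copy, toPath_ofSeq]
  rfl

theorem pi1Map_pi1Class {f : V → W} (hf : IsSimplicialMap K L f) {u : W} (h : f a = u)
    (w : EdgeWalk K a a) :
    pi1Map hf h w.pi1Class = ((w.map hf).copy h h).pi1Class := by
  subst h
  have h1 := FundamentalGroup.mapOfEq_apply (realizationMap hf) (realizationMap_vertex hf a)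
    w.pi1Class
  refine h1.trans ?_
  have h2 : (w.map hf).copy rfl rfl = w.map hf := rfl
  rw [h2, pi1Class, pi1Class, toPath_map]
  rfl

/-! ### Chains and classes in the first homology -/

variable {G : Type*} [AddCommGroup G]

/-- The chain `∑ g · e`, where `e` runs through the edges of an edge walk. -/
def chain (g : G) : {b : V} → EdgeWalk K a b → OrdChain G K 1
  | _, nil => 0
  | _, snoc w h => w.chain g + Finsupp.single (ordEdge h) g

theorem chain_append (g : G) (w : EdgeWalk K a b) (u : EdgeWalk K b c) :
    (w.append u).chain g = w.chain g + u.chain g := by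
  induction u with
  | nil => exact (add_zero _).symm
  | snoc u h ih => simp only [append, chain, ih, add_assoc]

theorem chain_single (g : G) (h : K.Adj a b) :
    (single h).chain g = Finsupp.single (ordEdge h) g :=
  zero_add _

theorem chain_copy {a' b' : V} (ha : a = a') (hb : b = b') (w : EdgeWalk K a b) (g : G) :
    (w.copy ha hb).chain g = w.chain g := by
  subst ha hb
  rfl

theorem chain_ofSeq (x : ℕ → V) (n : ℕ) (h : ∀ i < n, K.Adj (x i) (x (i + 1))) (g : G) :
    (ofSeq x n h).chain g = ∑ i : Fin n, Finsupp.single (ordEdge (h i i.2)) g := by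
  induction n with
  | zero => rfl
  | succ n ih =>
    rw [Fin.sum_univ_castSucc]
    simp only [ofSeq, chain, ih]

theorem boundary_chain (g : G) (w : EdgeWalk K a b) :
    boundary G K 0 (w.chain g) =
      Finsupp.single (ordVertex K b) g - Finsupp.single (ordVertex K a) g := by
  induction w with
  | nil => simp [chain]
  | snoc w h ih => rw [chain, map_add, ih, boundary_ordEdge]; abel

theorem chainMap_chain {f : V → W} (hf : IsSimplicialMap K L f) (g : G) (w : EdgeWalk K a b) :
    chainMap G hf 1 (w.chain g) = (w.map hf).chain g := by
  induction w with
  | nil => exact map_zero _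
  | @snoc b c w h ih =>
    rw [chain, map_add, ih, map, chain]
    congr 1
    rw [chainMap, Finsupp.mapDomain.addMonoidHom_apply, Finsupp.mapDomain_single]
    congr 1
    refine Subtype.ext (funext fun j => ?_)
    fin_cases j <;> rfl

theorem boundary_triangle {σ : Finset V} (hσ : σ ∈ K.faces) (ha : a ∈ σ) (hb : b ∈ σ) (hc : c ∈ σ)
    (hab : K.Adj a b) (hbc : K.Adj b c) (hac : K.Adj a c) (g : G) :
    boundary G K 1 (Finsupp.single ⟨![a, b, c], σ, hσ, by
      intro i; fin_cases i <;> assumption⟩ g) = Finsupp.single (ordEdge hbc) g -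
        Finsupp.single (ordEdge hac) g + Finsupp.single (ordEdge hab) g := by
  set v : OrdSimplex K 2 := ⟨![a, b, c], σ, hσ, by intro i; fin_cases i <;> assumption⟩ with hv
  have e0 : v.face 0 = ordEdge hbc := Subtype.ext (by funext j; fin_cases j <;> rfl)
  have e1 : v.face 1 = ordEdge hac := Subtype.ext (by funext j; fin_cases j <;> rfl)
  have e2 : v.face 2 = ordEdge hab := Subtype.ext (by funext j; fin_cases j <;> rfl)
  simp [boundary, Fin.sum_univ_three, e0, e1, e2, sub_eq_add_neg]

theorem Equiv.chain_sub_mem {w w' : EdgeWalk K a b} (h : w.Equiv w') (g : G) :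
    w.chain g - w'.chain g ∈ (boundary G K 1).range := by
  induction h with
  | refl w => rw [sub_self]; exact zero_mem _
  | symm _ ih => rw [← neg_sub]; exact neg_mem ih
  | trans _ _ ih ih' => rw [← sub_add_sub_cancel]; exact add_mem ih ih'
  | append _ _ ih ih' =>
    rw [chain_append, chain_append, add_sub_add_comm]
    exact add_mem ih ih'
  | loop h =>
    obtain ⟨σ, hσ, ha, -⟩ := id h
    -- The degenerate simplex `(a, a, a)` has boundary `(a, a) - (a, a) + (a, a) = (a, a)`.
    refine ⟨_, (boundary_triangle hσ ha ha ha h h h g).trans ?_⟩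
    simp [chain]
  | triangle hσ ha hb hc hab hbc hac =>
    refine ⟨_, (boundary_triangle hσ ha hb hc hab hbc hac g).trans ?_⟩
    rw [chain_append, chain_single, chain_single, chain_single]
    abel

/-- The class `g · [w]` of a closed edge walk in the first homology. -/
def h1Class (w : EdgeWalk K a a) (g : G) : H1 G K :=
  QuotientAddGroup.mk ⟨w.chain g, by rw [AddMonoidHom.mem_ker, boundary_chain, sub_self]⟩

theorem h1Class_eq {w : EdgeWalk K a a} {w' : EdgeWalk K b b} {g : G}
    (h : w.chain g - w'.chain g ∈ (boundary G K 1).range) : w.h1Class g = w'.h1Class g := by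
  refine (QuotientAddGroup.eq_iff_sub_mem).2 ?_
  exact h

theorem Equiv.h1Class_eq {w w' : EdgeWalk K a a} (h : w.Equiv w') (g : G) :
    w.h1Class g = w'.h1Class g :=
  EdgeWalk.h1Class_eq (h.chain_sub_mem g)

theorem h1Class_copy_ofSeq {x : ℕ → V} {n : ℕ} (h0 : x 0 = a) (hn : x n = a)
    (h : ∀ i < n, K.Adj (x i) (x (i + 1))) (g : G) :
    ((ofSeq x n h).copy h0 hn).h1Class g =
      AbstractSimplicialComplex.h1Class K x n h0 hn h g := by
  refine congrArg QuotientAddGroup.mk (Subtype.ext ?_)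
  exact (chain_copy h0 hn _ g).trans (chain_ofSeq x n h g)

theorem h1Map_h1Class {f : V → W} (hf : IsSimplicialMap K L f) (w : EdgeWalk K a a) (g : G) :
    h1Map G hf (w.h1Class g) = (w.map hf).h1Class g :=
  congrArg QuotientAddGroup.mk (Subtype.ext (chainMap_chain hf g w))

theorem chain_zero (w : EdgeWalk K a b) : w.chain (0 : G) = 0 := by
  induction w with
  | nil => rfl
  | snoc w h ih => rw [chain, ih, Finsupp.single_zero, add_zero]

theorem chain_add (w : EdgeWalk K a b) (g g' : G) :
    w.chain (g + g') = w.chain g + w.chain g' := by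
  induction w with
  | nil => exact (add_zero _).symm
  | snoc w h ih => rw [chain, chain, chain, ih, Finsupp.single_add, add_add_add_comm]

variable (G) in
/-- The subgroup of the first homology generated by the classes of closed edge walks at `u`. -/
def loopSubgroup (K : AbstractSimplicialComplex V) (u : V) : AddSubgroup (H1 G K) :=
  AddSubgroup.closure {x | ∃ (w : EdgeWalk K u u) (g : G), w.h1Class g = x}

/-- `D` replaces a vertex by its chosen walk from `u`. For one edge `(a, b)` the loop `P a`, then
`(a, b)`, then `P b` reversed has chain `(a, b) - D ∂(a, b)` up to boundaries; the general case is
additive. On a cycle the term `D ∂c` vanishes. -/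
theorem exists_chain_decomposition {u : V} (P : ∀ v, EdgeWalk K u v)
    (D : OrdChain G K 0 →+ OrdChain G K 1)
    (hD : ∀ v g, D (Finsupp.single (ordVertex K v) g) = (P v).chain g) (c : OrdChain G K 1) :
    ∃ z : (boundary G K 0).ker, (QuotientAddGroup.mk z : H1 G K) ∈ loopSubgroup G K u ∧
      c - D (boundary G K 0 c) - z ∈ (boundary G K 1).range := by
  induction c using Finsupp.induction_linear with
  | zero =>
    refine ⟨0, zero_mem _, ?_⟩
    simp only [map_zero, sub_zero, ZeroMemClass.coe_zero]
    exact zero_mem _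
  | add c c' ih ih' =>
    obtain ⟨z, hz, h⟩ := ih
    obtain ⟨z', hz', h'⟩ := ih'
    refine ⟨z + z', add_mem hz hz', ?_⟩
    have e : c + c' - D (boundary G K 0 (c + c')) - ((z + z' : (boundary G K 0).ker) :
        OrdChain G K 1) = (c - D (boundary G K 0 c) - z) + (c' - D (boundary G K 0 c') - z') := by
      rw [map_add, map_add, AddSubgroup.coe_add]
      abel
    rw [e]
    exact add_mem h h'
  | single v g =>
    obtain ⟨a, b, h, rfl⟩ : ∃ (a b : V) (h : K.Adj a b), v = ordEdge h := by
      obtain ⟨σ, hσ, h⟩ := v.2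
      exact ⟨v.1 0, v.1 1, ⟨σ, hσ, h 0, h 1⟩, Subtype.ext (by funext j; fin_cases j <;> rfl)⟩
    let w : EdgeWalk K u u := (P a).append ((single h).append (P b).reverse)
    refine ⟨⟨w.chain g, by rw [AddMonoidHom.mem_ker, boundary_chain, sub_self]⟩,
      AddSubgroup.subset_closure ⟨w, g, rfl⟩, ?_⟩
    have h1 := (Equiv.append_reverse (P b)).chain_sub_mem g
    rw [chain_append] at h1
    have e : Finsupp.single (ordEdge h) g - D (boundary G K 0 (Finsupp.single (ordEdge h) g)) -
        w.chain g = -((P b).chain g + (P b).reverse.chain g - chain g (nil : EdgeWalk K u u)) := by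
      rw [boundary_ordEdge, map_sub, hD, hD, chain_append, chain_append, chain_single]
      simp only [chain]
      abel
    exact e ▸ neg_mem h1

theorem loopSubgroup_eq_top {u : V} (hK : ∀ v, Nonempty (EdgeWalk K u v)) :
    loopSubgroup G K u = ⊤ := by
  let P : ∀ v, EdgeWalk K u v := fun v => (hK v).some
  let D : OrdChain G K 0 →+ OrdChain G K 1 := Finsupp.liftAddHom fun v =>
    { toFun := fun g => (P (v.1 0)).chain g
      map_zero' := chain_zero _
      map_add' := chain_add _ }
  have hD : ∀ v g, D (Finsupp.single (ordVertex K v) g) = (P v).chain g := fun v g =>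
    Finsupp.liftAddHom_apply_single _ _ _
  refine eq_top_iff.2 fun x _ => ?_
  obtain ⟨c, rfl⟩ := QuotientAddGroup.mk_surjective x
  obtain ⟨z, hz, h⟩ := exists_chain_decomposition P D hD c.1
  have hc : boundary G K 0 c.1 = 0 := c.2
  rw [hc, map_zero, sub_zero] at h
  have e : (QuotientAddGroup.mk c : H1 G K) = QuotientAddGroup.mk z :=
    QuotientAddGroup.eq_iff_sub_mem.2 h
  rw [e]
  exact hz

/-! ### Lifting edge walks along simplicial maps -/

/-- The conjugates of successive edges telescope: at each inner vertex `b` the detour along `e b`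
and back cancels. -/
theorem exists_map_equiv_of_edges {f : V → W} (hf : IsSimplicialMap K L f) (t : W → V)
    (e : ∀ w, L.Adj (f (t w)) w)
    (H : ∀ a b (h : L.Adj a b), ∃ c : EdgeWalk K (t a) (t b), (c.map hf).Equiv
      ((single (e a)).append ((single h).append (single (e b).symm)))) {a b : W}
    (w : EdgeWalk L a b) : ∃ c : EdgeWalk K (t a) (t b), (c.map hf).Equiv
      ((single (e a)).append (w.append (single (e b).symm))) := by
  induction w with
  | nil =>
    refine ⟨nil, ?_⟩
    rw [nil_append]
    exact (Equiv.cancel _ _).symm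
  | @snoc b c w h ih =>
    obtain ⟨x, hx⟩ := ih
    obtain ⟨y, hy⟩ := H _ _ h
    refine ⟨x.append y, ?_⟩
    rw [map_append]
    refine (hx.append hy).trans ?_
    have h1 := ((Equiv.cancel (e b).symm (e b)).append_left ((single (e a)).append w)).append_right
      ((single h).append (single (e c).symm))
    rw [append_nil] at h1
    rw [← append_single w h]
    simpa only [append_assoc] using h1

theorem surjective_pi1Map {f : V → W} (hf : IsSimplicialMap K L f) (t : W → V)
    (e : ∀ w, L.Adj (f (t w)) w)
    (H : ∀ a b (h : L.Adj a b), ∃ c : EdgeWalk K (t a) (t b), (c.map hf).Equiv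
      ((single (e a)).append ((single h).append (single (e b).symm)))) {v : V} {u : W}
    (hv : t u = v) (hu : f v = u) : Function.Surjective (pi1Map hf hu) := by
  intro γ
  obtain ⟨w, rfl⟩ := exists_pi1Class_eq γ
  obtain ⟨c, hc⟩ := exists_map_equiv_of_edges hf t e H w
  subst hv
  exact ⟨c.pi1Class, (pi1Map_pi1Class hf hu c).trans
    (Equiv.copy_of_conj hu hu (e u) (e u).symm hc).pi1Class_eq⟩

/-- It suffices to hit the generators `g · [w]`. No condition on base points is needed, because in
homology the two conjugating edges `e u` and its reverse cancel. -/
theorem surjective_h1Map {f : V → W} (hf : IsSimplicialMap K L f) (t : W → V)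
    (e : ∀ w, L.Adj (f (t w)) w)
    (H : ∀ a b (h : L.Adj a b), ∃ c : EdgeWalk K (t a) (t b), (c.map hf).Equiv
      ((single (e a)).append ((single h).append (single (e b).symm)))) {u : W}
    (hL : ∀ w, Nonempty (EdgeWalk L u w)) : Function.Surjective (h1Map G hf) := by
  rw [← AddMonoidHom.range_eq_top, eq_top_iff, ← loopSubgroup_eq_top hL, loopSubgroup,
    AddSubgroup.closure_le]
  rintro _ ⟨w, g, rfl⟩
  obtain ⟨c, hc⟩ := exists_map_equiv_of_edges hf t e H w
  refine ⟨c.h1Class g, (h1Map_h1Class hf c g).trans (EdgeWalk.h1Class_eq ?_)⟩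
  have h1 := hc.chain_sub_mem g
  have h2 := (Equiv.cancel (e u) (e u).symm).chain_sub_mem g
  have h3 := add_mem h1 h2
  rw [chain_append, chain_append, chain_append] at h3
  convert h3 using 1
  simp only [chain]
  abel

end EdgeWalk
end AbstractSimplicialComplex

/-! ### Geodesics and their approximation by a dense set -/

section Geodesic

variable {X : Type*} [MetricSpace X]

/-- Since the length equals the distance, the triangle inequality is an equality along `γ`, and the
distance from `x` serves as arc-length parameter; the intermediate value theorem shows that it takes
every value. -/
theorem IsGeodesicSpace.exists_param (hX : IsGeodesicSpace X) (x y : X) :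
    ∃ z : ℝ → X, z 0 = x ∧ z (dist x y) = y ∧ ∀ r ∈ Set.Icc 0 (dist x y),
      ∀ r' ∈ Set.Icc 0 (dist x y), dist (z r) (z r') = |r - r'| := by
  obtain ⟨γ, hγ⟩ := hX x y
  have hle : ∀ s t, s ≤ t → dist (γ s) (γ t) = dist x (γ t) - dist x (γ s) := by
    intro s t hst
    -- The partition `0 ≤ s ≤ t ≤ 1`, whose variation sum is bounded by the length of `γ`.
    let u : ℕ → unitInterval := fun n => if n = 0 then 0 else if n = 1 then s else
      if n = 2 then t else 1
    have hu : Monotone u := monotone_nat_of_le_succ fun n => by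
      rcases n with _ | _ | _ | n
      · exact unitInterval.nonneg'
      · exact hst
      · exact unitInterval.le_one'
      · exact le_rfl
    have h := eVariationOn.sum_le (f := γ) (s := Set.univ) (n := 3) hu (fun _ => Set.mem_univ _)
    rw [hγ, Finset.sum_range_succ, Finset.sum_range_succ, Finset.sum_range_one] at h
    have h' : edist (γ s) (γ 0) + edist (γ t) (γ s) + edist (γ 1) (γ t) ≤ edist x y := h
    rw [γ.source, γ.target, edist_dist, edist_dist, edist_dist, edist_dist,
      ← ENNReal.ofReal_add dist_nonneg dist_nonneg,
      ← ENNReal.ofReal_add (add_nonneg dist_nonneg dist_nonneg) dist_nonneg,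
      ENNReal.ofReal_le_ofReal_iff dist_nonneg] at h'
    have h1 := dist_triangle x (γ t) y
    have h2 := dist_triangle x (γ s) (γ t)
    rw [dist_comm (γ s) x, dist_comm (γ t) (γ s), dist_comm y (γ t)] at h'
    linarith
  have hdist : ∀ s t, dist (γ s) (γ t) = |dist x (γ s) - dist x (γ t)| := by
    intro s t
    rcases le_total s t with h | h
    · rw [hle s t h, abs_sub_comm, abs_of_nonneg]
      rw [← hle s t h]; exact dist_nonneg
    · rw [dist_comm, hle t s h, abs_of_nonneg]
      rw [← hle t s h]; exact dist_nonneg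
  have hc : Continuous fun t => dist x (γ t) := continuous_const.dist γ.continuous
  have hex : ∀ r, ∃ t, r ∈ Set.Icc 0 (dist x y) → dist x (γ t) = r := by
    intro r
    by_cases hr : r ∈ Set.Icc 0 (dist x y)
    · have h := intermediate_value_univ (0 : unitInterval) 1 hc
      simp only [γ.source, γ.target, dist_self] at h
      obtain ⟨t, ht⟩ := h hr
      exact ⟨t, fun _ => ht⟩
    · exact ⟨0, fun h => (hr h).elim⟩
  choose t ht using hex
  have h0 : (0 : ℝ) ∈ Set.Icc 0 (dist x y) := ⟨le_rfl, dist_nonneg⟩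
  have h1 : dist x y ∈ Set.Icc 0 (dist x y) := ⟨dist_nonneg, le_rfl⟩
  refine ⟨fun r => γ (t r), ?_, ?_, fun r hr r' hr' => ?_⟩
  · exact (dist_eq_zero.1 (ht 0 h0)).symm
  · refine dist_eq_zero.1 ?_
    have h2 := hdist (t (dist x y)) 1
    rwa [ht _ h1, γ.target, sub_self, abs_zero] at h2
  · rw [hdist, ht r hr, ht r' hr']

/-- Along a geodesic from `a` to `b` there are points `z i`, with consecutive distances less than
`ε`, and points `y i` of a dense set such that `y i` and `y (i + 1)` are both close to `z i`. -/
theorem IsGeodesicSpace.exists_seq (hX : IsGeodesicSpace X) {S : Set X} {s ε : ℝ}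
    (hS : IsDenseAt S s) (hε : 0 < ε) {a b : X} {y y' : S} (ha : dist (y : X) a < s)
    (hb : dist (y' : X) b < s) :
    ∃ (m N : ℕ) (z : ℕ → X) (Y : ℕ → S), m ≤ N ∧ z 0 = a ∧ z N = b ∧ Y 0 = y ∧ Y N = y' ∧
      (∀ i, dist (z i) (z (i + 1)) < ε) ∧
      (∀ i < N, dist (Y i : X) (z i) < s ∧ dist (Y (i + 1) : X) (z i) < s) ∧
      (∀ i, dist a (z i) ≤ dist a b) ∧
      (∀ i ≤ m, dist a (z i) ≤ dist a b / 2) ∧ (∀ i ≥ m, dist (z i) b ≤ dist a b / 2) := by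
  classical
  obtain ⟨ψ, h0, h1, hψ⟩ := hX.exists_param a b
  set D := dist a b with hD
  have hD0 : 0 ≤ D := dist_nonneg
  have hcont : ContinuousOn ψ (Set.Icc 0 D) := by
    have : LipschitzOnWith 1 ψ (Set.Icc 0 D) := LipschitzOnWith.of_dist_le_mul fun r hr r' hr' => by
      rw [hψ r hr r' hr', NNReal.coe_one, one_mul, Real.dist_eq]
    exact this.continuousOn
  -- With steps shorter than `δ`, one ball of radius `s` about a point of `S` contains two
  -- consecutive geodesic points. This gives strict bounds by `s` with no loss of an `ε`.
  obtain ⟨δ, hδ, hball⟩ := lebesgue_number_lemma_of_metric (c := fun y : S => Metric.ball (y : X) s)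
    (isCompact_Icc.image_of_continuousOn hcont) (fun _ => Metric.isOpen_ball) fun x _ => by
      obtain ⟨y, hy, hxy⟩ := hS x
      exact Set.mem_iUnion.2 ⟨⟨y, hy⟩, hxy⟩
  obtain ⟨k, hk⟩ := exists_nat_gt (D / min ε δ)
  have hmin : 0 < min ε δ := lt_min hε hδ
  have hk0 : (0 : ℝ) < k := (div_nonneg hD0 hmin.le).trans_lt hk
  have hkne : (k : ℝ) ≠ 0 := hk0.ne'
  -- An even number of equal steps makes index `k` the exact midpoint; from index `2 * k` on the
  -- parameter stays at `D`, so the sequence repeats `b`.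
  let τ : ℕ → ℝ := fun i => (min i (2 * k) : ℕ) * (D / (2 * k))
  have hη : 0 ≤ D / (2 * k) := by positivity
  have hη' : D / (2 * k) < min ε δ := by
    rw [div_lt_iff₀ hmin] at hk
    rw [div_lt_iff₀ (by positivity)]
    nlinarith
  have hτend : ((2 * k : ℕ) : ℝ) * (D / (2 * k)) = D := by
    push_cast
    field_simp
  have hτmid : (k : ℝ) * (D / (2 * k)) = D / 2 := by
    field_simp
  have hτ : ∀ i, τ i ∈ Set.Icc 0 D := fun i => by
    refine ⟨mul_nonneg (Nat.cast_nonneg _) hη, ?_⟩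
    rw [← hτend]
    exact mul_le_mul_of_nonneg_right (Nat.cast_le.2 (min_le_right _ _)) hη
  have hD01 : (0 : ℝ) ∈ Set.Icc 0 D := ⟨le_rfl, hD0⟩
  have hD11 : D ∈ Set.Icc 0 D := ⟨hD0, le_rfl⟩
  let z : ℕ → X := fun i => ψ (τ i)
  have hz0 : z 0 = a := by simp [z, τ, h0]
  have hzend : ∀ i, 2 * k ≤ i → z i = b := fun i hi => by
    have : τ i = D := by simp only [τ]; rw [min_eq_right hi, hτend]
    simp only [z]; rw [this, h1]
  have haz : ∀ i, dist a (z i) = τ i := fun i => by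
    rw [← h0, hψ 0 hD01 (τ i) (hτ i), zero_sub, abs_neg, abs_of_nonneg (hτ i).1]
  have hzb : ∀ i, dist (z i) b = D - τ i := fun i => by
    rw [← h1, hψ (τ i) (hτ i) D hD11, abs_sub_comm, abs_of_nonneg (sub_nonneg.2 (hτ i).2)]
  have hstep : ∀ i, dist (z i) (z (i + 1)) < min ε δ := fun i => by
    refine lt_of_le_of_lt ?_ hη'
    rw [hψ _ (hτ i) _ (hτ (i + 1)), abs_sub_comm]
    simp only [τ]
    rw [← sub_mul, abs_mul, abs_of_nonneg hη]
    refine mul_le_of_le_one_left hη ?_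
    rcases le_or_gt (2 * k) i with h | h
    · rw [min_eq_right h, min_eq_right (h.trans i.le_succ), sub_self, abs_zero]
      exact zero_le_one
    · rw [min_eq_left h.le, min_eq_left (Nat.succ_le_of_lt h)]
      simp
  choose c hc using fun i => hball (z i) ⟨τ i, hτ i, rfl⟩
  -- The shift by one lets `Y i = c (i - 1)` be close to both `z (i - 1)` and `z i`. The extra index
  -- `2 * k + 1`, where `z` rests at `b`, leaves room for the final jump to `y'`.
  let Y : ℕ → S := fun i => if i = 0 then y else if i ≤ 2 * k then c (i - 1) else y'
  have hY0 : Y 0 = y := if_pos rfl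
  have hYs : ∀ i < 2 * k, Y (i + 1) = c i := fun i hi => by
    simp only [Y]; rw [if_neg i.succ_ne_zero, if_pos (Nat.succ_le_of_lt hi), Nat.add_sub_cancel]
  have hYe : Y (2 * k + 1) = y' := by
    simp only [Y]; rw [if_neg (Nat.succ_ne_zero _), if_neg (by omega)]
  refine ⟨k, 2 * k + 1, z, Y, by omega, hz0, hzend _ (by omega), hY0, hYe,
    fun i => (hstep i).trans_le (min_le_left _ _), fun i hi => ⟨?_, ?_⟩, fun i => ?_,
    fun i hi => ?_, fun i hi => ?_⟩
  · rcases i with _ | i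
    · rw [hY0, hz0]; exact ha
    · rw [hYs i (by omega), dist_comm]
      refine hc i ?_
      rw [Metric.mem_ball, dist_comm]
      exact (hstep i).trans_le (min_le_right _ _)
  · rcases Nat.lt_succ_iff_lt_or_eq.1 hi with h | rfl
    · rw [hYs i h, dist_comm]
      exact hc i (Metric.mem_ball_self hδ)
    · rw [hYe, hzend _ le_rfl]; exact hb
  · rw [haz]; exact (hτ i).2
  · rw [haz, ← hτmid]
    exact mul_le_mul_of_nonneg_right (Nat.cast_le.2 ((min_le_left _ _).trans hi)) hη
  · rw [hzb]
    have : D / 2 ≤ τ i := by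
      rw [← hτmid]
      exact mul_le_mul_of_nonneg_right (Nat.cast_le.2 (le_min hi (by omega))) hη
    linarith

/-- Fixing `S` pointwise preserves the base point and makes the inclusion of `S` a right inverse of
`f`, which is used for the surjectivity of `ν`. -/
theorem IsDenseAt.exists_retraction {S : Set X} {s : ℝ} (hs : 0 < s) (hS : IsDenseAt S s) :
    ∃ f : X → S, (∀ x : X, dist x (f x : X) < s) ∧ ∀ y : S, f y = y := by
  classical
  choose g hg hgs using hS
  refine ⟨fun x => if h : x ∈ S then ⟨x, h⟩ else ⟨g x, hg x⟩, fun x => ?_, fun y => ?_⟩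
  · by_cases h : x ∈ S
    · simpa [h] using hs
    · simpa [h] using hgs x
  · simp

end Geodesic

namespace AbstractSimplicialComplex.EdgeWalk

variable {V W : Type*} {K : AbstractSimplicialComplex V} {L : AbstractSimplicialComplex W}

theorem map_ofSeq {f : V → W} (hf : IsSimplicialMap K L f) (x : ℕ → V) (n : ℕ)
    (h : ∀ i < n, K.Adj (x i) (x (i + 1))) (h' : ∀ i < n, L.Adj (f (x i)) (f (x (i + 1)))) :
    (ofSeq x n h).map hf = ofSeq (fun i => f (x i)) n h' := by
  induction n with
  | zero => rfl
  | succ n ih =>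
    simp only [ofSeq, map]
    rw [ih]

theorem map_copy {f : V → W} (hf : IsSimplicialMap K L f) {a b a' b' : V} (ha : a = a')
    (hb : b = b') (w : EdgeWalk K a b) :
    (w.copy ha hb).map hf = (w.map hf).copy (congrArg f ha) (congrArg f hb) := by
  subst ha hb
  rfl

theorem copy_copy {a b a' b' a'' b'' : V} (ha : a = a') (hb : b = b') (ha' : a' = a'')
    (hb' : b' = b'') (w : EdgeWalk K a b) :
    (w.copy ha hb).copy ha' hb' = w.copy (ha.trans ha') (hb.trans hb') := by
  subst ha hb ha' hb'
  rfl

theorem Equiv.copy {a b a' b' : V} (ha : a = a') (hb : b = b') {w w' : EdgeWalk K a b}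
    (h : w.Equiv w') : (w.copy ha hb).Equiv (w'.copy ha hb) := by
  subst ha hb
  exact h

theorem h1Class_copy {G : Type*} [AddCommGroup G] {a a' : V} (ha : a = a') (w : EdgeWalk K a a)
    (g : G) : (w.copy ha ha).h1Class g = w.h1Class g := by
  subst ha
  rfl

end AbstractSimplicialComplex.EdgeWalk

/-! ### Homotopies of walks in Rips complexes -/

section RipsWalks

open EdgeWalk

variable {X Y : Type*} [MetricSpace X] [MetricSpace Y] {r : ℝ}

/-- The diameter of a finite set is attained, so strict bounds on pairs give a strict bound on the
diameter: the Rips complex is a flag complex. -/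
theorem mem_rips_faces (hr : 0 < r) {σ : Finset X} (hσ : σ.Nonempty)
    (h : ∀ a ∈ σ, ∀ b ∈ σ, dist a b < r) : σ ∈ (Rips X r hr).faces := by
  obtain ⟨x, hx, hmax⟩ := (σ ×ˢ σ).exists_max_image (fun x => dist x.1 x.2) (hσ.product hσ)
  rw [Finset.mem_product] at hx
  refine ⟨hσ, lt_of_le_of_lt (Metric.diam_le_of_forall_dist_le dist_nonneg fun a ha b hb => ?_)
    (h _ hx.1 _ hx.2)⟩
  exact hmax (a, b) (Finset.mem_product.2 ⟨ha, hb⟩)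

theorem dist_lt_of_mem_rips_faces {hr : 0 < r} {σ : Finset X} (hσ : σ ∈ (Rips X r hr).faces)
    {a b : X} (ha : a ∈ σ) (hb : b ∈ σ) : dist a b < r :=
  (Metric.dist_le_diam_of_mem σ.finite_toSet.isBounded ha hb).trans_lt hσ.2

theorem dist_lt_of_rips_adj {hr : 0 < r} {a b : X} (h : (Rips X r hr).Adj a b) : dist a b < r := by
  obtain ⟨σ, hσ, ha, hb⟩ := h
  exact dist_lt_of_mem_rips_faces hσ ha hb

theorem isSimplicialMap_rips {r' : ℝ} {hr : 0 < r} {hr' : 0 < r'} {f : X → Y}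
    (hf : ∀ a b, dist a b < r → dist (f a) (f b) < r') :
    IsSimplicialMap (Rips X r hr) (Rips Y r' hr') f := by
  classical
  intro σ hσ
  refine ⟨σ.image f, mem_rips_faces hr' (hσ.1.image f) fun a ha b hb => ?_,
    fun v hv => Finset.mem_image_of_mem f hv⟩
  obtain ⟨a', ha', rfl⟩ := Finset.mem_image.1 ha
  obtain ⟨b', hb', rfl⟩ := Finset.mem_image.1 hb
  exact hf a' b' (dist_lt_of_mem_rips_faces hσ ha' hb')

variable {hr : 0 < r} {a b c a' b' : X}

theorem rips_triangle (hab : (Rips X r hr).Adj a b) (hbc : (Rips X r hr).Adj b c)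
    (hac : (Rips X r hr).Adj a c) :
    ((single hab).append (single hbc)).Equiv (single hac) := by
  classical
  have h1 := dist_lt_of_rips_adj hab
  have h2 := dist_lt_of_rips_adj hbc
  have h3 := dist_lt_of_rips_adj hac
  refine Equiv.triangle (σ := {a, b, c}) (mem_rips_faces hr ⟨a, by simp⟩ ?_) (by simp) (by simp)
    (by simp) _ _ _
  intro x hx y hy
  simp only [Finset.mem_insert, Finset.mem_singleton] at hx hy
  rcases hx with rfl | rfl | rfl <;> rcases hy with rfl | rfl | rfl <;>
    first
      | assumption
      | (rw [dist_comm]; assumption)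
      | (rw [dist_self]; exact hr)

theorem rips_conj (ha : (Rips X r hr).Adj a' a) (hab : (Rips X r hr).Adj a b)
    (hb : (Rips X r hr).Adj b b') (h : (Rips X r hr).Adj a' b) (h' : (Rips X r hr).Adj a' b') :
    ((single ha).append ((single hab).append (single hb))).Equiv (single h') := by
  rw [← append_assoc]
  exact ((rips_triangle ha hab h).append_right _).trans (rips_triangle h hb h')

/-- The walk is coned off in two fans of triangles: up to index `m` from `x 0`, and from `m` on from
`x n`. With two apexes, each vertex has to be close to only one end. -/
theorem rips_collapse {x : ℕ → X} {n m : ℕ} (hmn : m ≤ n)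
    (h : ∀ i < n, (Rips X r hr).Adj (x i) (x (i + 1))) (h0 : (Rips X r hr).Adj (x 0) (x n))
    (h1 : ∀ i ≤ m, (Rips X r hr).Adj (x 0) (x i))
    (h2 : ∀ i, m ≤ i → i ≤ n → (Rips X r hr).Adj (x n) (x i)) :
    (ofSeq x n h).Equiv (single h0) := by
  have k1 : ∀ i (hi : i ≤ m),
      (ofSeq x i fun j hj => h j (hj.trans_le (hi.trans hmn))).Equiv (single (h1 i hi)) := by
    intro i
    induction i with
    | zero => exact fun _ => (Equiv.loop _).symm
    | succ i ih =>
      intro hi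
      exact ((ih (i.le_succ.trans hi)).append_right
        (single (h i (Nat.lt_of_succ_le (hi.trans hmn))))).trans (rips_triangle _ _ _)
  have k2 : ∀ i (hmi : m ≤ i) (hi : i ≤ n), (ofSeq x i fun j hj => h j (hj.trans_le hi)).Equiv
      ((single h0).append (single (h2 i hmi hi))) := by
    intro i hmi
    induction i, hmi using Nat.le_induction with
    | base => exact fun _ => (k1 m le_rfl).trans (rips_triangle _ _ _).symm
    | succ i hmi ih =>
      intro hi
      refine ((ih (i.le_succ.trans hi)).append_right
        (single (h i (Nat.lt_of_succ_le hi)))).trans ?_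
      rw [append_assoc]
      exact (rips_triangle _ _ _).append_left _
  exact (k2 n hmn le_rfl).trans ((Equiv.loop _).append_left _)

/-- Two sequences `x`, `y` such that `x i` is adjacent to `y i` and `y (i + 1)` give homotopic
edge walks. -/
theorem rips_contiguous {x y : ℕ → X} {n : ℕ} (hx : ∀ i < n, (Rips X r hr).Adj (x i) (x (i + 1)))
    (hy : ∀ i < n, (Rips X r hr).Adj (y i) (y (i + 1)))
    (hxy : ∀ i ≤ n, (Rips X r hr).Adj (x i) (y i))
    (hxy' : ∀ i < n, (Rips X r hr).Adj (x i) (y (i + 1))) :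
    (ofSeq y n hy).Equiv ((single (hxy 0 n.zero_le).symm).append
      ((ofSeq x n hx).append (single (hxy n le_rfl)))) := by
  induction n with
  | zero =>
    simp only [ofSeq]
    rw [nil_append]
    exact (Equiv.cancel _ _).symm
  | succ n ih =>
    have h1 := ((ih (fun i hi => hx i (hi.trans n.lt_succ_self))
      (fun i hi => hy i (hi.trans n.lt_succ_self)) (fun i hi => hxy i (hi.trans n.le_succ))
      (fun i hi => hxy' i (hi.trans n.lt_succ_self))).append_right
        (single (hy n n.lt_succ_self)))
    refine h1.trans ?_
    rw [append_assoc, append_assoc]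
    refine Equiv.append_left _ ?_
    have e : ofSeq x (n + 1) hx = (ofSeq x n fun i hi => hx i (hi.trans n.lt_succ_self)).append
      (single (hx n n.lt_succ_self)) := rfl
    rw [e, append_assoc]
    refine Equiv.append_left _ ?_
    exact (rips_triangle _ _ (hxy' n n.lt_succ_self)).trans (rips_triangle _ _ _).symm

end RipsWalks

/-! ### Surjectivity of the maps between Rips complexes -/

section Surjectivity

open EdgeWalk

variable {X : Type*} [MetricSpace X] {S : Set X} {s p q : ℝ}

theorem IsGeodesicSpace.nonempty_edgeWalk (hX : IsGeodesicSpace X) (hp : 0 < p) (a b : X) :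
    Nonempty (EdgeWalk (Rips X p hp) a b) := by
  -- Only the subdivision `z` is wanted; the dense set is taken to be the whole space.
  obtain ⟨-, N, z, -, -, rfl, rfl, -, -, hz, -⟩ := hX.exists_seq (S := Set.univ) (s := 1)
    (fun x => ⟨x, trivial, by simp⟩) hp (a := a) (b := b) (y := ⟨a, trivial⟩) (y' := ⟨b, trivial⟩)
    (by simp) (by simp)
  exact ⟨ofSeq z N fun i _ => rips_adj hp (hz i)⟩

theorem IsGeodesicSpace.nonempty_edgeWalk_dense (hX : IsGeodesicSpace X) (hs : 0 < s)
    (hS : IsDenseAt S s) (hp : 0 < p) (hsp : 2 * s ≤ p) (a b : S) :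
    Nonempty (EdgeWalk (Rips S p hp) a b) := by
  obtain ⟨-, N, z, Y, -, -, -, rfl, rfl, -, hY, -⟩ := hX.exists_seq hS hp
    (a := (a : X)) (b := (b : X)) (y := a) (y' := b) (by simpa using hs) (by simpa using hs)
  refine ⟨ofSeq Y N fun i hi => rips_adj hp ?_⟩
  have h1 := dist_triangle_right (Y i : X) (Y (i + 1)) (z i)
  have h2 := hY i hi
  rw [Subtype.dist_eq]
  linarith

/-- An edge of the Rips complex of `X` is homotopic, up to short edges, to a walk in `S`. -/
theorem IsGeodesicSpace.exists_dense_walk (hX : IsGeodesicSpace X) (hs : 0 < s)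
    (hS : IsDenseAt S s) (hp : 0 < p) (hsp : 2 * s ≤ p) {a b : X} {y y' : S}
    (ha : dist (y : X) a < s) (hb : dist (y' : X) b < s) (h : (Rips X p hp).Adj a b)
    (ea : (Rips X p hp).Adj (y : X) a) (eb : (Rips X p hp).Adj b (y' : X)) :
    ∃ c : EdgeWalk (Rips S p hp) y y', (c.map (isSimplicialMap_incl S hp)).Equiv
      ((single ea).append ((single h).append (single eb))) := by
  have hD := dist_lt_of_rips_adj h
  obtain ⟨m, N, z, Y, hm, rfl, rfl, rfl, rfl, hz, hY, haz, hz1, hz2⟩ := hX.exists_seq hS hp ha hb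
  have hYs : ∀ i < N, dist (Y i : X) (Y (i + 1) : X) < p := fun i hi => by
    have h1 := dist_triangle_right (Y i : X) (Y (i + 1)) (z i)
    have h2 := hY i hi
    linarith
  refine ⟨ofSeq Y N fun i hi => rips_adj hp (hYs i hi), ?_⟩
  rw [map_ofSeq _ _ _ _ fun i hi => rips_adj hp (hYs i hi)]
  have h1 : ∀ i ≤ N, (Rips X p hp).Adj (z i) (Y i : X) := fun i hi => by
    rcases hi.eq_or_lt with rfl | hi
    · exact eb
    · refine rips_adj hp ?_
      rw [dist_comm]
      linarith [(hY i hi).1]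
  -- A ladder joins the walk `Y` in `S` to the geodesic walk `z`, which then collapses to the edge
  -- because it stays within `dist a b < p` of its ends.
  refine (rips_contiguous (x := z) (fun i _ => rips_adj hp (hz i)) _ h1 fun i hi =>
    rips_adj hp ?_).trans ?_
  · rw [dist_comm]
    linarith [(hY i hi).2]
  · refine Equiv.append_left _ (Equiv.append_right ?_ _)
    refine rips_collapse hm _ h (fun i _ => rips_adj hp ((haz i).trans_lt hD)) fun i hmi _ =>
      rips_adj hp ?_
    rw [dist_comm]
    refine (hz2 i hmi).trans_lt ((half_le_self dist_nonneg).trans_lt hD)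

theorem IsGeodesicSpace.surjective_mu (hX : IsGeodesicSpace X) (G : Type*) [AddCommGroup G]
    (hs : 0 < s) (hS : IsDenseAt S s) (x₀ : S) (hp : 0 < p) (hsp : 2 * s ≤ p) :
    Function.Surjective (muPi1 S hp x₀) ∧ Function.Surjective (muH1 G S hp) := by
  obtain ⟨f, hf, hfS⟩ := hS.exists_retraction hs
  have hf' : ∀ x, dist (f x : X) x < s := fun x => by rw [dist_comm]; exact hf x
  have e : ∀ x, (Rips X p hp).Adj (f x : X) x := fun x => rips_adj hp (by linarith [hf' x])
  have H : ∀ a b (h : (Rips X p hp).Adj a b), ∃ c : EdgeWalk (Rips S p hp) (f a) (f b),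
      (c.map (isSimplicialMap_incl S hp)).Equiv
        ((single (e a)).append ((single h).append (single (e b).symm))) := fun a b h =>
    hX.exists_dense_walk hs hS hp hsp (hf' a) (hf' b) h _ _
  exact ⟨surjective_pi1Map _ f e H (hfS x₀) rfl,
    surjective_h1Map _ f e H fun w => hX.nonempty_edgeWalk hp (x₀ : X) w⟩

theorem IsGeodesicSpace.surjective_bond (hX : IsGeodesicSpace X) (G : Type*) [AddCommGroup G]
    (x₀ : X) (hp : 0 < p) (hq : 0 < q) (hpq : p < q) :
    Function.Surjective (bondPi1 hp hq hpq.le x₀) ∧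
      Function.Surjective (bondH1 X G hp hq hpq.le) := by
  have e : ∀ x : X, (Rips X q hq).Adj (id (id x)) x := fun x => Adj.refl _ x
  have H : ∀ a b (h : (Rips X q hq).Adj a b), ∃ c : EdgeWalk (Rips X p hp) (id a) (id b),
      (c.map (isSimplicialMap_bond hp hq hpq.le)).Equiv
        ((single (e a)).append ((single h).append (single (e b).symm))) := by
    intro a b h
    have hD := dist_lt_of_rips_adj h
    obtain ⟨m, N, z, -, hm, rfl, rfl, -, -, hz, -, haz, -, hz2⟩ := hX.exists_seq (S := Set.univ)
      (s := 1) (fun x => ⟨x, trivial, by simp⟩) hp (a := a) (b := b) (y := ⟨a, trivial⟩)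
      (y' := ⟨b, trivial⟩) (by simp) (by simp)
    refine ⟨ofSeq z N fun i _ => rips_adj hp (hz i), ?_⟩
    rw [map_ofSeq (isSimplicialMap_bond hp hq hpq.le) z N _ fun i hi =>
      rips_adj hq ((hz i).trans hpq)]
    refine (rips_collapse hm _ h (fun i _ => rips_adj hq ((haz i).trans_lt hD)) fun i hmi _ =>
      rips_adj hq ?_).trans (rips_conj _ _ _ h h).symm
    rw [dist_comm]
    exact (hz2 i hmi).trans_lt ((half_le_self dist_nonneg).trans_lt hD)
  exact ⟨surjective_pi1Map _ id e H rfl rfl,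
    surjective_h1Map _ id e H fun w => hX.nonempty_edgeWalk hq x₀ w⟩

/-- The walk leaves the geodesic by less than `s`, so the bound by the full distance would be too
weak for collapsing. On each half, the distance to the nearer end is below `q / 2 + s`, and `2 * s ≤
p < q` makes this less than `q`. -/
theorem IsGeodesicSpace.surjective_bond_dense (hX : IsGeodesicSpace X) (G : Type*)
    [AddCommGroup G] (hs : 0 < s) (hS : IsDenseAt S s) (x₀ : S) (hp : 0 < p) (hq : 0 < q)
    (hpq : p < q) (hsp : 2 * s ≤ p) :
    Function.Surjective (bondPi1 hp hq hpq.le x₀) ∧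
      Function.Surjective (bondH1 S G hp hq hpq.le) := by
  have e : ∀ x : S, (Rips S q hq).Adj (id (id x)) x := fun x => Adj.refl _ x
  have H : ∀ a b (h : (Rips S q hq).Adj a b), ∃ c : EdgeWalk (Rips S p hp) (id a) (id b),
      (c.map (isSimplicialMap_bond hp hq hpq.le)).Equiv
        ((single (e a)).append ((single h).append (single (e b).symm))) := by
    intro a b h
    have hD : dist a b < q := dist_lt_of_rips_adj h
    rw [Subtype.dist_eq] at hD
    obtain ⟨m, N, z, Y, hm, hz0, hzN, rfl, rfl, hz, hY, haz, hz1, hz2⟩ := hX.exists_seq hS hp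
      (a := (a : X)) (b := (b : X)) (y := a) (y' := b) (by simpa using hs) (by simpa using hs)
    have hYs : ∀ i < N, dist (Y i) (Y (i + 1)) < p := fun i hi => by
      have h1 := dist_triangle_right (Y i : X) (Y (i + 1)) (z i)
      have h2 := hY i hi
      rw [Subtype.dist_eq]
      linarith
    have hYz : ∀ i ≤ N, dist (Y i : X) (z i) < s := fun i hi => by
      rcases hi.eq_or_lt with rfl | hi
      · rw [hzN, dist_self]; exact hs
      · exact (hY i hi).1
    refine ⟨ofSeq Y N fun i hi => rips_adj hp (hYs i hi), ?_⟩
    rw [map_ofSeq (isSimplicialMap_bond hp hq hpq.le) Y N _ fun i hi =>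
      rips_adj hq ((hYs i hi).trans hpq)]
    refine (rips_collapse hm _ h (fun i hi => rips_adj hq ?_) fun i hmi hi =>
      rips_adj hq ?_).trans (rips_conj _ _ _ h h).symm
    · have h1 := dist_triangle_right (Y 0 : X) (Y i) (z i)
      have h2 := hYz i (hi.trans hm)
      have h3 := hz1 i hi
      change dist (Y 0 : X) (Y i) < q
      linarith
    · have h1 := dist_triangle_right (Y N : X) (Y i) (z i)
      have h2 := hYz i hi
      have h3 := hz2 i hmi
      rw [dist_comm] at h3
      change dist (Y N : X) (Y i) < q
      linarith
  exact ⟨surjective_pi1Map _ id e H rfl rfl,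
    surjective_h1Map _ id e H fun w => hX.nonempty_edgeWalk_dense hs hS hq (hsp.trans hpq.le) x₀ w⟩

theorem dist_retraction_lt {f : X → S} (hf : ∀ x : X, dist x (f x : X) < s) (a b : X)
    (hab : dist a b < p) : dist (f a) (f b) < p + 2 * s := by
  have h1 := dist_triangle4 (f a : X) a b (f b)
  have h2 := hf a
  have h3 := hf b
  rw [dist_comm] at h2
  rw [Subtype.dist_eq]
  linarith

/-- The inclusion of `S` is the backward vertex map. An edge of length below `p + 2 * s` is
subdivided in `X` and pushed to `S` by `f`; on each half the image is within `(p + 2 * s) / 2 + s <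
p + 2 * s` of the nearer end, so it collapses with no condition relating `p` and `s`. -/
theorem IsGeodesicSpace.surjective_retraction (hX : IsGeodesicSpace X) (G : Type*)
    [AddCommGroup G] (hs : 0 < s) (hS : IsDenseAt S s) (x₀ : S) (hp : 0 < p)
    (hps : 0 < p + 2 * s) {f : X → S} (hfS : ∀ y : S, f y = y)
    (hf : ∀ x : X, dist x (f x : X) < s)
    (hsimp : IsSimplicialMap (Rips X p hp) (Rips S (p + 2 * s) hps) f) :
    Function.Surjective (pi1Map hsimp (hfS x₀)) ∧ Function.Surjective (h1Map G hsimp) := by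
  have e : ∀ x : S, (Rips S (p + 2 * s) hps).Adj (f x) x := fun x => by
    rw [hfS]
    exact Adj.refl _ x
  have H : ∀ a b (h : (Rips S (p + 2 * s) hps).Adj a b),
      ∃ c : EdgeWalk (Rips X p hp) (a : X) (b : X), (c.map hsimp).Equiv
        ((single (e a)).append ((single h).append (single (e b).symm))) := by
    intro a b h
    have hD : dist a b < p + 2 * s := dist_lt_of_rips_adj h
    rw [Subtype.dist_eq] at hD
    obtain ⟨m, N, z, -, hm, hz0, hzN, -, -, hz, -, haz, hz1, hz2⟩ := hX.exists_seq hS hp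
      (a := (a : X)) (b := (b : X)) (y := a) (y' := b) (by simpa using hs) (by simpa using hs)
    have h1 : (Rips S (p + 2 * s) hps).Adj (f a) b := by rw [hfS]; exact h
    have h2 : (Rips S (p + 2 * s) hps).Adj (f a) (f b) := by rw [hfS, hfS]; exact h
    suffices h3 : ∃ c : EdgeWalk (Rips X p hp) (a : X) (b : X), (c.map hsimp).Equiv
        (single h2) by
      obtain ⟨c, hc⟩ := h3
      exact ⟨c, hc.trans (rips_conj _ _ _ h1 h2).symm⟩
    have ka : ∀ i ≤ m, dist (f a) (f (z i)) < p + 2 * s := fun i hi => by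
      have h4 := dist_triangle (a : X) (z i) (f (z i))
      have h5 := hf (z i)
      have h6 := hz1 i hi
      rw [hfS, Subtype.dist_eq]
      linarith
    have kb : ∀ i, m ≤ i → dist (f b) (f (z i)) < p + 2 * s := fun i hi => by
      have h4 := dist_triangle (b : X) (z i) (f (z i))
      have h5 := hf (z i)
      have h6 := hz2 i hi
      rw [dist_comm] at h6
      rw [hfS, Subtype.dist_eq]
      linarith
    generalize (a : X) = a' at *
    generalize (b : X) = b' at *
    subst hz0 hzN
    refine ⟨ofSeq z N fun i _ => rips_adj hp (hz i), ?_⟩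
    rw [map_ofSeq _ _ _ _ fun i hi => rips_adj hps (dist_retraction_lt hf _ _ (hz i))]
    exact rips_collapse hm _ h2 (fun i hi => rips_adj hps (ka i hi)) fun i hmi _ =>
      rips_adj hps (kb i hmi)
  exact ⟨surjective_pi1Map _ _ e H rfl (hfS x₀), surjective_h1Map _ _ e H fun w =>
    hX.nonempty_edgeWalk_dense hs hS hps (by linarith) x₀ w⟩

end Surjectivity

/-! ### The map `ν`: defining property and uniqueness -/

section Nu

open EdgeWalk

variable {X : Type*} [MetricSpace X] {S : Set X} {s p : ℝ} {G : Type*} [AddCommGroup G]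

/-- The edge walk of a based loop. -/
def RLoop.walk {r : ℝ} {x₀ : X} (L : RLoop X r x₀) (hr : 0 < r) : EdgeWalk (Rips X r hr) x₀ x₀ :=
  (ofSeq L.x L.n fun i hi => rips_adj hr (L.step i hi)).copy L.first L.last

theorem RLoop.pi1Class_walk {r : ℝ} {x₀ : X} (L : RLoop X r x₀) (hr : 0 < r) :
    (L.walk hr).pi1Class = L.pi1Class hr :=
  pi1Class_copy_ofSeq _ _ _

theorem RLoop.h1Class_walk {r : ℝ} {x₀ : X} (L : RLoop X r x₀) (hr : 0 < r) (g : G) :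
    (L.walk hr).h1Class g = L.h1Class hr g :=
  h1Class_copy_ofSeq _ _ _ _

theorem exists_rLoop_walk_eq {r : ℝ} {hr : 0 < r} {x₀ : X} (w : EdgeWalk (Rips X r hr) x₀ x₀) :
    ∃ L : RLoop X r x₀, L.walk hr = w := by
  obtain ⟨x, n, h0, hn, h, rfl⟩ := w.exists_seq
  exact ⟨⟨n, x, h0, hn, fun i hi => dist_lt_of_rips_adj (h i hi)⟩, rfl⟩

/-- The approximation `y` and the image of `x` under `f` form a ladder: its rungs are shorter than
`2 * s`, and its diagonals from `y i` to `f (x (i + 1))` are shorter than `s + p + s`, exactly the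
scale of the target. -/
theorem RLoop.Approximates.walk_equiv {x₀ : S} {L : RLoop X p (x₀ : X)}
    {L' : RLoop S (p + 2 * s) x₀} (h : L'.Approximates L s) (hp : 0 < p) (hps : 0 < p + 2 * s)
    {f : X → S} (hf : ∀ x : X, dist x (f x : X) < s) (hfS : f x₀ = x₀)
    (hsimp : IsSimplicialMap (Rips X p hp) (Rips S (p + 2 * s) hps) f) :
    (((L.walk hp).map hsimp).copy hfS hfS).Equiv (L'.walk hps) := by
  obtain ⟨n, x, h0, hn, hx⟩ := L
  obtain ⟨n', y, h0', hn', hy⟩ := L'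
  obtain ⟨rfl, hxy⟩ := h
  simp only at hxy h0 hn hx
  have h1 : ∀ i ≤ n', dist (y i) (f (x i)) < p + 2 * s := fun i hi => by
    have h4 := dist_triangle_left (y i : X) (f (x i)) (x i)
    have h5 := hf (x i)
    have h6 := hxy i hi
    rw [Subtype.dist_eq]
    linarith
  have h2 : ∀ i < n', dist (y i) (f (x (i + 1))) < p + 2 * s := fun i hi => by
    have h3 := dist_triangle_left (y i : X) (f (x (i + 1))) (x i)
    have h4 := dist_triangle (x i : X) (x (i + 1)) (f (x (i + 1)))
    have h5 := hf (x (i + 1))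
    have h6 := hxy i hi.le
    have h7 := hx i hi
    rw [Subtype.dist_eq]
    linarith
  have key := rips_contiguous (hr := hps) (x := y) (y := fun i => f (x i)) (n := n')
    (fun i hi => rips_adj hps (hy i hi))
    (fun i hi => rips_adj hps (dist_retraction_lt hf _ _ (hx i hi)))
    (fun i hi => rips_adj hps (h1 i hi)) (fun i hi => rips_adj hps (h2 i hi))
  have e0 : f (x 0) = y 0 := by rw [h0, hfS, h0']
  have en : f (x n') = y n' := by rw [hn, hfS, hn']
  have h3 := (EdgeWalk.Equiv.copy_of_conj e0 en _ _ key).copy h0' hn'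
  rw [copy_copy] at h3
  simp only [RLoop.walk]
  rw [map_copy, copy_copy, map_ofSeq]
  exact h3

theorem isNuPi1_pi1Map {x₀ : S} {hp : 0 < p} {hps : 0 < p + 2 * s} {f : X → S}
    (hf : ∀ x : X, dist x (f x : X) < s) (hfS : f x₀ = x₀)
    (hsimp : IsSimplicialMap (Rips X p hp) (Rips S (p + 2 * s) hps) f) :
    IsNuPi1 hp hps x₀ (pi1Map hsimp hfS) := by
  intro L L' h
  rw [← L.pi1Class_walk, ← L'.pi1Class_walk, pi1Map_pi1Class]
  exact (h.walk_equiv hp hps hf hfS hsimp).pi1Class_eq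

theorem isNuH1_h1Map {x₀ : S} {hp : 0 < p} {hps : 0 < p + 2 * s} {f : X → S}
    (hf : ∀ x : X, dist x (f x : X) < s) (hfS : f x₀ = x₀)
    (hsimp : IsSimplicialMap (Rips X p hp) (Rips S (p + 2 * s) hps) f) :
    IsNuH1 hp hps x₀ (h1Map G hsimp) := by
  intro L L' h g
  rw [← L.h1Class_walk, ← L'.h1Class_walk, h1Map_h1Class, ← h1Class_copy hfS]
  exact (h.walk_equiv hp hps hf hfS hsimp).h1Class_eq g

theorem RLoop.exists_approximates {x₀ : S} (L : RLoop X p (x₀ : X)) {f : X → S}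
    (hf : ∀ x : X, dist x (f x : X) < s) (hfS : f x₀ = x₀) :
    ∃ L' : RLoop S (p + 2 * s) x₀, L'.Approximates L s :=
  ⟨⟨L.n, fun i => f (L.x i), by rw [L.first, hfS], by rw [L.last, hfS],
    fun i hi => dist_retraction_lt hf _ _ (L.step i hi)⟩, rfl, fun i _ => hf (L.x i)⟩

theorem IsNuPi1.unique {x₀ : S} {hp : 0 < p} {hps : 0 < p + 2 * s} {f : X → S}
    (hf : ∀ x : X, dist x (f x : X) < s) (hfS : f x₀ = x₀)
    {ν ν' : Pi1 (Rips X p hp) (x₀ : X) →* Pi1 (Rips S (p + 2 * s) hps) x₀}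
    (h : IsNuPi1 hp hps x₀ ν) (h' : IsNuPi1 hp hps x₀ ν') : ν' = ν := by
  refine MonoidHom.ext fun γ => ?_
  obtain ⟨w, rfl⟩ := exists_pi1Class_eq γ
  obtain ⟨L, rfl⟩ := exists_rLoop_walk_eq w
  obtain ⟨L', hL⟩ := L.exists_approximates hf hfS
  rw [L.pi1Class_walk, h L L' hL, h' L L' hL]

/-- Two such homomorphisms agree on each `g · [L]`, as every loop has an approximation. These
classes generate `H₁` because geodesics join every vertex to the base point by an edge walk. -/
theorem IsNuH1.unique (hX : IsGeodesicSpace X) {x₀ : S} {hp : 0 < p} {hps : 0 < p + 2 * s}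
    {f : X → S} (hf : ∀ x : X, dist x (f x : X) < s) (hfS : f x₀ = x₀)
    {ν ν' : H1 G (Rips X p hp) →+ H1 G (Rips S (p + 2 * s) hps)}
    (h : IsNuH1 hp hps x₀ ν) (h' : IsNuH1 hp hps x₀ ν') : ν' = ν := by
  have key : (⊤ : AddSubgroup (H1 G (Rips X p hp))) ≤ AddMonoidHom.eqLocus ν' ν := by
    rw [← loopSubgroup_eq_top (hX.nonempty_edgeWalk hp (x₀ : X)), loopSubgroup,
      AddSubgroup.closure_le]
    rintro _ ⟨w, g, rfl⟩
    obtain ⟨L, rfl⟩ := exists_rLoop_walk_eq w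
    obtain ⟨L', hL⟩ := L.exists_approximates hf hfS
    change ν' _ = ν _
    rw [L.h1Class_walk, h L L' hL, h' L L' hL]
  exact AddMonoidHom.ext fun x => key (AddSubgroup.mem_top x)

end Nu

end

/-! ### The main theorem -/

theorem mainTheorem7 {X : Type*} [MetricSpace X] (hX : IsGeodesicSpace X)
    (G : Type*) [AddCommGroup G] (S : Set X) (s : ℝ) (hs : 0 < s) (hS : IsDenseAt S s) (x₀ : S) :
    (∀ (p : ℝ) (hp : 0 < p), 2 * s ≤ p →
      Function.Surjective (muPi1 S hp x₀) ∧ Function.Surjective (muH1 G S hp)) ∧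
    (∀ (p q : ℝ) (hp : 0 < p) (hq : 0 < q) (hpq : p < q), 2 * s ≤ p →
      Function.Surjective (bondPi1 hp hq hpq.le x₀) ∧
      Function.Surjective (bondH1 S G hp hq hpq.le) ∧
      Function.Surjective (bondPi1 hp hq hpq.le (x₀ : X)) ∧
      Function.Surjective (bondH1 X G hp hq hpq.le)) ∧
    (∀ (p : ℝ) (hp : 0 < p) (hps : 0 < p + 2 * s),
      (∃ ν : AbstractSimplicialComplex.Pi1 (Rips X p hp) (x₀ : X) →*
          AbstractSimplicialComplex.Pi1 (Rips S (p + 2 * s) hps) x₀,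
        IsNuPi1 hp hps x₀ ν ∧ (∀ ν', IsNuPi1 hp hps x₀ ν' → ν' = ν) ∧ Function.Surjective ν) ∧
      (∃ ν : AbstractSimplicialComplex.H1 G (Rips X p hp) →+
          AbstractSimplicialComplex.H1 G (Rips S (p + 2 * s) hps),
        IsNuH1 hp hps x₀ ν ∧ (∀ ν', IsNuH1 hp hps x₀ ν' → ν' = ν) ∧ Function.Surjective ν)) := by

  obtain ⟨f, hf, hfS⟩ := hS.exists_retraction hs
  refine ⟨fun p hp hsp => hX.surjective_mu G hs hS x₀ hp hsp, fun p q hp hq hpq hsp => ?_,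
    fun p hp hps => ?_⟩
  · obtain ⟨h1, h2⟩ := hX.surjective_bond_dense G hs hS x₀ hp hq hpq hsp
    obtain ⟨h3, h4⟩ := hX.surjective_bond G (x₀ : X) hp hq hpq
    exact ⟨h1, h2, h3, h4⟩
  -- One retraction `f`, independent of `p`, induces `ν` on both `π₁` and `H₁`.
  · have hsimp : AbstractSimplicialComplex.IsSimplicialMap (Rips X p hp)
        (Rips S (p + 2 * s) hps) f :=
      isSimplicialMap_rips (dist_retraction_lt hf)
    obtain ⟨h1, h2⟩ := hX.surjective_retraction G hs hS x₀ hp hps hfS hf hsimp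
    have h3 := isNuPi1_pi1Map hf (hfS x₀) hsimp
    have h4 := isNuH1_h1Map (G := G) hf (hfS x₀) hsimp
    exact ⟨⟨_, h3, fun ν' h => IsNuPi1.unique hf (hfS x₀) h3 h, h1⟩,
      ⟨_, h4, fun ν' h => IsNuH1.unique hX hf (hfS x₀) h4 h, h2⟩⟩
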